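/- **Setting.** For a subspace $V\subseteq\mathbb R^d$ write $x^V$ for the orthogonal projection of $x$ onto $V$, and $x^{\perp V}$ for the projection onto $V^\perp$. For a probability distribution $D$ on a space $X$ and $a>0$, a $\mathrm{VSTAT}(a)$ oracle for $D$ answers a query $q:X\to[-1,1]$ with a number within $\max\bigl(1/a,\sqrt{\mathrm{Var}_D[q]/a}\bigr)$ of $\mathbb E_D[q]$. A statistical query (SQ) algorithm is a possibly randomized, computationally unbounded algorithm which accesses $D$ only by adaptively chosen queries $q$ to $\mathrm{VSTAT}(a)$ oracles, with $a>0$ chosen at each query, and which finally returns an output. For a finite set $\mathcal Y$, a class $\mathcal F$ of functions $\mathbb R^d\to\mathcal Y$ and $\mathrm{OPT}\in(0,1)$, an *$\mathrm{OPT}$-noisy instance of $\mathcal F$* is a distribution $D'$ on $\mathbb R^d\times\mathcal Y$ whose $x$-marginal is $N(0,I)$ and for which some $c\in\mathcal F$ has $\Pr_{(x,y)\sim D'}[c(x)\ne y]\le\mathrm{OPT}$. An SQ algorithm *learns $\mathcal F$ in the presence of $\mathrm{OPT}$ adversarial label noise up to error smaller than $\varepsilon$ with probability at least $2/3$* if for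 every $\mathrm{OPT}$-noisy instance $D'$ of $\mathcal F$ and all valid oracles for $D'$ it returns, with probability at least $2/3$, a hypothesis $h:\mathbb R^d\to\mathcal Y$ with $\Pr_{(x,y)\sim D'}[h(x)\neq y]<\varepsilon$. **Theorem.** There are absolute constants $c,a,c_1,c_2>0$ such that the following holds. Let $d,K,m\ge1$ be integers with $d^c\ge\max(m,K)$, let $\mathcal Y$ be a finite set, and let $\tau,\mathrm{OPT}\in(0,1)$ with $\tau,\mathrm{OPT}\ge d^{-am}$. Let $f:\mathbb R^d\to\mathcal Y$ be measurable, let $(x,y)$ be a random variable on $\mathbb R^d\times\mathcal Y$ with $x\sim N(0,I)$ and $\Pr[f(x)\ne y]=\mathrm{OPT}$, and let $W,V\subseteq\mathbb R^d$ be subspaces with $\dim W\le K$. Put $U=(V+W)\cap V^\perp$ and suppose that 1. $f(x)=f(x^W)$ for all $x$; 2. $\Pr_{x\sim N(0,I)}[g(x^V)\ne f(x)]\ge\tau$ for every measurable $g:V\to\mathcal Y$; 3. for every $i\in\mathcal Y$ and every polynomial $p:U\to\mathbb R$ of degree at most $m$ with $\mathbb E_{x\sim N(0,I)}[p(x^U)]=0$,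 one has $\mathbb E[p(x^U)\mathbf 1(y=i)\mid x^V]=0$ almost surely. Let $\mathcal F$ be any class of functions $\mathbb R^d\to\mathcal Y$ that contains all the functions $$x\mapsto f(x^{\perp U}+Qx),\qquad Q:\mathbb R^d\to U\text{ linear},\quad QQ^\top=\mathrm{id}_U,\quad Q\,w^V=0\text{ for all }w\in W$$ (these are the rotated functions $f\circ R$, with $R$ ranging over the orthogonal transformations of $\mathbb R^d$ that fix $W^V=\{w^V:w\in W\}$ pointwise; one may, for instance, take $\mathcal F$ to be exactly this family, or the family of the same functions for all $Q$ with $QQ^\top=\mathrm{id}_U$). Then any SQ algorithm that learns $\mathcal F$ in the presence of $\mathrm{OPT}$ adversarial label noise up to error smaller than $\tau-2\,\mathrm{OPT}$ with probability at least $2/3$ makes at least $2^{d^{c_1}}$ queries or at least one query to $\mathrm{VSTAT}(a')$ with $a'\ge d^{c_2m}/|\mathcal Y|$; that is, for some $\mathrm{OPT}$-noisy instance of $\mathcal F$ and some valid oracle for it, one of the two happens with positive probability over the internal randomness of the algorithm. -/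

import Mathlib

open MeasureTheory ProbabilityTheory

universe u v w

namespace SQLower

noncomputable section

/-! ### Statistical query algorithms -/

/-- A statistical query on `X`: a (measurable) function `q : X → [-1, 1]`. -/
structure StatQuery (X : Type u) [MeasurableSpace X] where
  toFun : X → ℝ
  measurable_toFun : Measurable toFun
  mem_Icc : ∀ x, toFun x ∈ Set.Icc (-1 : ℝ) 1

/-- The tolerance `max (1/a, √(Var_D[q]/a))` of the oracle `VSTAT(a)` for the distribution `D`. -/
def vstatTolerance {X : Type u} [MeasurableSpace X] (D : Measure X) (q : StatQuery X) (a : ℝ) : ℝ :=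
  max (1 / a) (Real.sqrt (variance q.toFun D / a))

/-- `O` assigns to each query `q` and each accuracy parameter `a` a real number. It is a valid
oracle for `D` if, for every `a > 0`, `O · a` is a `VSTAT(a)` oracle for `D`. -/
def IsVSTATOracle {X : Type u} [MeasurableSpace X] (D : Measure X) (O : StatQuery X → ℝ → ℝ) :
    Prop :=
  ∀ (q : StatQuery X) (a : ℝ), 0 < a → |O q a - ∫ x, q.toFun x ∂D| ≤ vstatTolerance D q a

/-- A deterministic adaptive statistical query algorithm with outputs in `H`: either it stops with
an output, or it sends a query `q` to `VSTAT(a)`, where `a > 0`, and continues depending on the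
real number it receives. No restriction is put on its computational power. -/
inductive SQAlg (X : Type u) [MeasurableSpace X] (H : Type v) : Type (max u v)
  | output (h : H) : SQAlg X H
  | query (q : StatQuery X) (a : ℝ) (ha : 0 < a) (next : ℝ → SQAlg X H) : SQAlg X H

namespace SQAlg

variable {X : Type u} [MeasurableSpace X] {H : Type v}

/-- The output of the run of an algorithm against the oracle `O`. -/
def result (O : StatQuery X → ℝ → ℝ) : SQAlg X H → H
  | output h => h
  | query q a _ next => result O (next (O q a))

/-- The list of the accuracy parameters `a` of the calls to `VSTAT(a)` in the run of an algorithm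
against the oracle `O`, one entry for each query made. -/
def accuracies (O : StatQuery X → ℝ → ℝ) : SQAlg X H → List ℝ
  | output _ => []
  | query q a _ next => a :: accuracies O (next (O q a))

/-- The number of queries made in the run of an algorithm against the oracle `O`. -/
def numQueries (O : StatQuery X → ℝ → ℝ) (A : SQAlg X H) : ℕ := (A.accuracies O).length

end SQAlg

/-! ### Learning with adversarial label noise under the Gaussian distribution -/

/-- `ℝᵈ` with the Euclidean norm. -/
abbrev Eu (d : ℕ) : Type := EuclideanSpace ℝ (Fin d)

/-- Hypotheses: measurable functions `ℝᵈ → Y`. -/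
abbrev Hyp (d : ℕ) (Y : Type v) [MeasurableSpace Y] : Type v := {h : Eu d → Y // Measurable h}

/-- The 0-1 error `Pr_{(x,y) ∼ D}[c(x) ≠ y]`. -/
def err01 {d : ℕ} {Y : Type v} [MeasurableSpace Y] (D : Measure (Eu d × Y)) (c : Eu d → Y) : ℝ :=
  D.real {z | c z.1 ≠ z.2}

/-- `D` is a distribution of labelled examples with standard Gaussian `x`-marginal. (Such a `D` is
automatically a probability measure.) -/
def HasGaussianMarginal {d : ℕ} {Y : Type v} [MeasurableSpace Y] (D : Measure (Eu d × Y)) : Prop :=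
  D.map Prod.fst = stdGaussian (Eu d)

/-- `D` is an instance of the class `F` with adversarial label noise at rate at most `opt`: its
`x`-marginal is standard Gaussian and its labels agree with some member of `F` except with
probability at most `opt`. -/
def IsNoisyInstance {d : ℕ} {Y : Type v} [MeasurableSpace Y] (F : Set (Eu d → Y)) (opt : ℝ)
    (D : Measure (Eu d × Y)) : Prop :=
  HasGaussianMarginal D ∧ ∃ c ∈ F, err01 D c ≤ opt

/-- The randomized algorithm `A`, with internal randomness `ω ∼ P`, learns the class `F` in the
presence of adversarial label noise at rate `opt` up to error smaller than `ε` with probability at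
least `2/3`: for every instance `D` and every valid oracle for `D`, the event that the hypothesis
it returns has error smaller than `ε` under `D` contains a measurable event of probability at
least `2/3`. -/
def Learns {d : ℕ} {Y : Type v} [MeasurableSpace Y] {Ω : Type w} [MeasurableSpace Ω]
    (P : Measure Ω) (A : Ω → SQAlg (Eu d × Y) (Hyp d Y)) (F : Set (Eu d → Y)) (opt ε : ℝ) : Prop :=
  ∀ D : Measure (Eu d × Y), IsNoisyInstance F opt D →
    ∀ O : StatQuery (Eu d × Y) → ℝ → ℝ, IsVSTATOracle D O →
      ∃ S : Set Ω, MeasurableSet S ∧ 2 / 3 ≤ P.real S ∧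
        ∀ ω ∈ S, err01 D ((A ω).result O).1 < ε

/-! ### The structural assumptions -/

/-- `U = (V + W) ∩ Vᗮ`. -/
def hiddenSubspace {d : ℕ} (V W : Submodule ℝ (Eu d)) : Submodule ℝ (Eu d) := (V ⊔ W) ⊓ Vᗮ

/-- `E[p(x^U) 1(y = i) | x^V] = 0` almost surely for `(x, y) ∼ D`, for all labels `i` and all
polynomials `p` of degree at most `m` on `U = (V + W) ∩ Vᗮ` with `E[p(x^U)] = 0`, `x ∼ N(0, I)`.
(The polynomials on `U` are the restrictions to `U` of the polynomials on `ℝᵈ`.) -/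
def MomentsVanish {d : ℕ} {Y : Type v} [MeasurableSpace Y] (D : Measure (Eu d × Y))
    (V W : Submodule ℝ (Eu d)) (m : ℕ) : Prop :=
  ∀ (i : Y) (p : MvPolynomial (Fin d) ℝ), p.totalDegree ≤ m →
    ∫ x, MvPolynomial.eval (fun j => (hiddenSubspace V W).starProjection x j) p
      ∂(stdGaussian (Eu d)) = 0 →
    D[{z : Eu d × Y | z.2 = i}.indicator
        (fun z => MvPolynomial.eval (fun j => (hiddenSubspace V W).starProjection z.1 j) p)
      | MeasurableSpace.comap (fun z : Eu d × Y => V.orthogonalProjectionOnto z.1) inferInstance]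
      =ᵐ[D] 0

/-- The family of the functions `x ↦ f(x^{⊥U} + Q x)`, where `U = (V + W) ∩ Vᗮ` and where
`Q : ℝᵈ → U` is linear with `Q Qᵀ = id` and vanishes on `W^V`, the projection of `W` onto `V`.
For `f` depending only on `x^W` these are the functions `f ∘ R` for the orthogonal
transformations `R` of `ℝᵈ` that fix `W^V` pointwise. -/
def rotatedFamily {d : ℕ} {Y : Type v} (f : Eu d → Y) (V W : Submodule ℝ (Eu d)) :
    Set (Eu d → Y) :=
  {c | ∃ Q : Eu d →ₗ[ℝ] hiddenSubspace V W,
      Q ∘ₗ LinearMap.adjoint Q = LinearMap.id ∧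
      (∀ x ∈ W, Q (V.starProjection x) = 0) ∧
      c = fun x => f ((hiddenSubspace V W)ᗮ.starProjection x + (Q x : Eu d))}

end

end SQLower

open scoped ENNReal NNReal RealInnerProductSpace

set_option linter.unusedSectionVars false

/-! ### Gaussian measures in coordinates -/

/-! The learner cannot find the position of U. Let η be the conditional law of the label given the
visible coordinates (those of x along W^V) and the hidden ones (those along U), see `labelKernel`.
Feeding η with the coordinates of x in another orthonormal frame orthogonal to W^V gives a planted
distribution; it is again a noisy instance, with a rotated copy of f as target. Averaging η over the
hidden Gaussian gives a null distribution, in which labels depend on the visible coordinates only.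
The best predictor for the null distribution is thus a function of x^V, and assumption 2 forces
every hypothesis to have null error at least τ - OPT (`le_nullExpectation_errQuery`).

The frames are indexed by sign vectors v. A frame (`signFrame`) uses the same v on each of dim U
orthonormal blocks of length n, so the Gram matrix between the frames of v and w is ρ times the
identity, with ρ = `signDot v w / n`. By a Chernoff bound |ρ| ≤ ε for all but a fraction 2
exp(-nε²/2) of the w. Two planted label deviations are then correlated through a pair of
ρ-correlated Gaussian vectors. The relevant density ratio is, up to a bounded factor, the
exponential of a quadratic polynomial of size O(ε); its Taylor terms of degree at most m contribute
nothing by assumption 3, and the remainder is of order (mKε)^(m/2+1) up to constants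
(`abs_sum_integral_corr_le`).

By Cauchy–Schwarz a single query then separates only a tiny fraction of the planted distributions
from the null one (`card_integral_gt_le`). An oracle that gives the null expectation whenever this
is a valid answer therefore leads the runs for most v to one common hypothesis
(`exists_common_result`). Fixing a random seed that succeeds for two thirds of the v, some such v
has its error within θ ≤ OPT of the null error, hence at least τ - 2 OPT, a contradiction
(`exists_noisyInstance_of_learns`). All parameters are powers of s = d^(1/40). -/

/-- The standard Gaussian measure on `ι → ℝ`. -/
noncomputable abbrev gaussPi (ι : Type*) [Fintype ι] : Measure (ι → ℝ) :=
  Measure.pi fun _ => gaussianReal 0 1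

/-- The inner products of `x` with a family of vectors. -/
noncomputable def coords {E ι : Type*} [NormedAddCommGroup E] [InnerProductSpace ℝ E]
    (w : ι → E) (x : E) : ι → ℝ := fun i => ⟪w i, x⟫

section coords

variable {E : Type*} [NormedAddCommGroup E] [InnerProductSpace ℝ E] [MeasurableSpace E]
  [BorelSpace E] {ι κ : Type*}

@[fun_prop]
lemma measurable_coords [Countable ι] (w : ι → E) : Measurable (coords w) :=
  (measurable_pi_lambda _ fun i => by
    have : Continuous fun x : E => ⟪w i, x⟫ := by fun_prop
    exact this.measurable)

variable [FiniteDimensional ℝ E] [Fintype ι] [Fintype κ]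

/-- The two characteristic functions agree because an orthonormal family satisfies ‖∑ tᵢ wᵢ‖ = ‖t‖.
-/
lemma map_coords_stdGaussian {w : ι → E} (hw : Orthonormal ℝ w) :
    (stdGaussian E).map (coords w) = gaussPi ι := by
  have hm : Measurable (fun x : E => WithLp.toLp 2 (coords w x)) := by fun_prop
  have key : (stdGaussian E).map (fun x : E => WithLp.toLp 2 (coords w x))
      = stdGaussian (EuclideanSpace ℝ ι) := by
    have := Measure.isProbabilityMeasure_map (μ := stdGaussian E) hm.aemeasurable
    apply Measure.ext_of_charFun
    ext t
    rw [charFun_stdGaussian, charFun_apply, integral_map hm.aemeasurable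
      (by fun_prop)]
    have h1 : ∀ x : E, ⟪WithLp.toLp 2 (coords w x), t⟫ = ⟪x, ∑ i, t i • w i⟫ := by
      intro x
      simp only [PiLp.inner_apply, coords, inner_sum, inner_smul_right]
      refine Finset.sum_congr rfl fun i _ => ?_
      simp [real_inner_comm]
    simp_rw [h1]
    rw [← charFun_apply, charFun_stdGaussian]
    have h2 : ‖∑ i, t i • w i‖ ^ 2 = ‖t‖ ^ 2 := by
      rw [← real_inner_self_eq_norm_sq, hw.inner_sum, EuclideanSpace.real_norm_sq_eq]
      simp [sq]
    rw [← Complex.ofReal_pow, h2, Complex.ofReal_pow]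
  rw [← map_pi_eq_stdGaussian] at key
  have h3 := congrArg (fun μ => μ.map (WithLp.ofLp : EuclideanSpace ℝ ι → ι → ℝ)) key
  simp only at h3
  rw [Measure.map_map (by fun_prop) hm, Measure.map_map (by fun_prop) (by fun_prop)] at h3
  have h4 : (WithLp.ofLp : EuclideanSpace ℝ ι → ι → ℝ) ∘ WithLp.toLp 2 = id := rfl
  rw [h4, Measure.map_id] at h3
  exact h3

lemma map_coords_prod_stdGaussian {v : ι → E} {w : κ → E} (h : Orthonormal ℝ (Sum.elim v w)) :
    (stdGaussian E).map (fun x => (coords v x, coords w x)) = (gaussPi ι).prod (gaussPi κ) := by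
  have h1 := (measurePreserving_sumPiEquivProdPi
    (fun _ : ι ⊕ κ => gaussianReal 0 1)).map_eq
  have h2 := map_coords_stdGaussian h
  unfold gaussPi at h2
  rw [← h2, Measure.map_map (by fun_prop) (by fun_prop)] at h1
  exact h1

end coords

/-! ### The density of a shifted and scaled Gaussian -/

/-- The density of `N(a, s²)` with respect to `N(0, 1)`. -/
noncomputable def shiftDensity (a s y : ℝ) : ℝ :=
  s⁻¹ * Real.exp (y ^ 2 / 2 - (y - a) ^ 2 / (2 * s ^ 2))

lemma measurable_shiftDensity (a s : ℝ) : Measurable (shiftDensity a s) := by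
  unfold shiftDensity; fun_prop

lemma shiftDensity_nonneg {a s y : ℝ} (hs : 0 < s) : 0 ≤ shiftDensity a s y := by
  unfold shiftDensity; positivity

lemma gaussianReal_map_affine {a s : ℝ} (hs : 0 < s) :
    (gaussianReal 0 1).map (fun z => a + s * z) =
      (gaussianReal 0 1).withDensity fun y => ENNReal.ofReal (shiftDensity a s y) := by
  have h1 : (gaussianReal 0 1).map (fun z => a + s * z) =
      ((gaussianReal 0 1).map (fun z => s * z)).map (fun z => a + z) := by
    rw [Measure.map_map (by fun_prop) (by fun_prop)]; rfl
  rw [h1, gaussianReal_map_const_mul, gaussianReal_map_const_add]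
  have hv : (NNReal.mk (s ^ 2) (sq_nonneg s) * 1 : ℝ≥0) ≠ 0 := by
    rw [mul_one]; intro h
    have := congrArg NNReal.toReal h
    simp at this; exact hs.ne' this
  rw [gaussianReal_of_var_ne_zero _ hv, gaussianReal_of_var_ne_zero _ one_ne_zero,
    ← withDensity_mul _ (measurable_gaussianPDF _ _)
      (measurable_shiftDensity a s).ennreal_ofReal]
  congr 1
  ext y
  simp only [Pi.mul_apply, gaussianPDF]
  rw [← ENNReal.ofReal_mul (gaussianPDFReal_nonneg _ _ _)]
  congr 1
  simp only [gaussianPDFReal, shiftDensity, NNReal.coe_one, mul_one, mul_zero,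
    zero_add, sub_zero, NNReal.coe_mk]
  rw [Real.sqrt_mul (by positivity), Real.sqrt_sq hs.le, mul_inv]
  have : -(y - a) ^ 2 / (2 * s ^ 2) = -y ^ 2 / 2 + (y ^ 2 / 2 - (y - a) ^ 2 / (2 * s ^ 2)) := by
    ring
  rw [this, Real.exp_add]
  ring

section pi

variable {κ : Type*} [Fintype κ]

/-- On a box, the indicator times the product density factors over the coordinates, which are
independent under the product measure; boxes determine it. -/
lemma pi_withDensity_ofReal {μ : κ → Measure ℝ} [∀ j, IsProbabilityMeasure (μ j)]
    {m : κ → ℝ → ℝ≥0∞} (hm : ∀ j, Measurable (m j))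
    [∀ j, IsProbabilityMeasure ((μ j).withDensity (m j))] :
    Measure.pi (fun j => (μ j).withDensity (m j)) =
      (Measure.pi μ).withDensity fun y => ∏ j, m j (y j) := by
  apply Measure.pi_eq
  intro s hs
  rw [withDensity_apply _ (MeasurableSet.univ_pi hs), ← lintegral_indicator
    (MeasurableSet.univ_pi hs)]
  have h1 : ∀ y : κ → ℝ, (Set.univ.pi s).indicator (fun y => ∏ j, m j (y j)) y =
      ∏ j, (s j).indicator (m j) (y j) := by
    intro y
    classical
    by_cases hy : y ∈ Set.univ.pi s
    · rw [Set.indicator_of_mem hy]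
      exact Finset.prod_congr rfl fun j _ => (Set.indicator_of_mem (hy j trivial) _).symm
    · rw [Set.indicator_of_notMem hy]
      simp only [Set.mem_pi, Set.mem_univ, true_imp_iff, not_forall] at hy
      obtain ⟨j, hj⟩ := hy
      exact (Finset.prod_eq_zero (Finset.mem_univ j) (Set.indicator_of_notMem hj _)).symm
  simp_rw [h1]
  rw [lintegral_prod_eq_prod_lintegral_of_indepFun Finset.univ
    (fun j (y : κ → ℝ) => (s j).indicator (m j) (y j))
    (iIndepFun_pi (X := fun j => (s j).indicator (m j))
      fun j => ((hm j).indicator (hs j)).aemeasurable)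
    (fun j => ((hm j).indicator (hs j)).comp (measurable_pi_apply j))]
  refine Finset.prod_congr rfl fun j _ => ?_
  rw [withDensity_apply _ (hs j), ← lintegral_indicator (hs j)]
  exact (measurePreserving_eval μ j).lintegral_comp ((hm j).indicator (hs j))

lemma gaussPi_map_affine {a : κ → ℝ} {s : ℝ} (hs : 0 < s) :
    (gaussPi κ).map (fun z j => a j + s * z j) =
      (gaussPi κ).withDensity fun y => ENNReal.ofReal (∏ j, shiftDensity (a j) s (y j)) := by
  have hp : ∀ j, IsProbabilityMeasure ((gaussianReal 0 1).map (fun z => a j + s * z)) :=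
    fun j => Measure.isProbabilityMeasure_map (by fun_prop)
  rw [Measure.pi_map_pi (f := fun j z => a j + s * z) (fun j => by fun_prop)]
  have hp' : ∀ j, IsProbabilityMeasure
      ((gaussianReal 0 1).withDensity fun y => ENNReal.ofReal (shiftDensity (a j) s y)) :=
    fun j => by rw [← gaussianReal_map_affine hs]; exact hp j
  simp_rw [gaussianReal_map_affine hs]
  rw [pi_withDensity_ofReal fun j => (measurable_shiftDensity _ _).ennreal_ofReal]
  congr 1
  ext y
  rw [ENNReal.ofReal_prod_of_nonneg fun j _ => shiftDensity_nonneg hs]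

/-! ### Exponential moments -/

lemma integral_exp_sq_gaussianReal {c : ℝ} (hc : c < 1 / 2) :
    Integrable (fun x => Real.exp (c * x ^ 2)) (gaussianReal 0 1) ∧
    ∫ x, Real.exp (c * x ^ 2) ∂(gaussianReal 0 1) = Real.sqrt (1 - 2 * c)⁻¹ := by
  have h0 : ∀ x : ℝ, gaussianPDFReal 0 1 x • Real.exp (c * x ^ 2) =
      (Real.sqrt (2 * Real.pi))⁻¹ * Real.exp (-(1 / 2 - c) * x ^ 2) := by
    intro x
    simp only [gaussianPDFReal, NNReal.coe_one, mul_one, sub_zero, smul_eq_mul]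
    rw [mul_assoc, ← Real.exp_add]
    congr 2; ring
  constructor
  · rw [gaussianReal_of_var_ne_zero _ one_ne_zero,
      integrable_withDensity_iff_integrable_smul' (measurable_gaussianPDF _ _)
        (Filter.Eventually.of_forall fun x => gaussianPDF_lt_top)]
    simp_rw [toReal_gaussianPDF, h0]
    exact (integrable_exp_neg_mul_sq (by linarith)).const_mul _
  · rw [integral_gaussianReal_eq_integral_smul one_ne_zero]
    simp_rw [h0]
    rw [integral_const_mul, integral_gaussian, ← Real.sqrt_inv, ← Real.sqrt_mul (by positivity)]
    congr 1
    have : (1 - 2 * c) ≠ 0 := by linarith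
    have : (1 / 2 - c) ≠ 0 := by intro h; apply this; linarith
    field_simp

lemma integral_exp_sum_sq_gaussPi {c : ℝ} (hc : c < 1 / 2) :
    Integrable (fun y : κ → ℝ => Real.exp (c * ∑ j, y j ^ 2)) (gaussPi κ) ∧
    ∫ y, Real.exp (c * ∑ j, y j ^ 2) ∂(gaussPi κ) =
      Real.sqrt (1 - 2 * c)⁻¹ ^ Fintype.card κ := by
  simp_rw [Finset.mul_sum, Real.exp_sum]
  refine ⟨Integrable.fintype_prod (f := fun _ x => Real.exp (c * x ^ 2))
    fun _ => (integral_exp_sq_gaussianReal hc).1, ?_⟩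
  rw [integral_fintype_prod_eq_prod (f := fun _ x => Real.exp (c * x ^ 2)),
    (integral_exp_sq_gaussianReal hc).2, Finset.prod_const, Finset.card_univ]

end pi

/-! ### Correlations of functions with vanishing low-degree moments -/

/-- The remainder is at most |x|ⁿ exp|x|. The power qⁿ is absorbed by n! exp q ≤ nⁿ exp q, so that
only an exponential of q is left to integrate, with the small factor δⁿ in front. -/
lemma abs_exp_sub_taylor_le {x δ q : ℝ} (n : ℕ) (hδ : 0 ≤ δ) (hδ1 : δ ≤ 1) (hq : 0 ≤ q)
    (hx : |x| ≤ δ * q) :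
    |Real.exp x - ∑ j ∈ Finset.range n, x ^ j / (j.factorial : ℝ)| ≤
      (n * δ) ^ n * Real.exp (2 * q) := by
  have h1 : |Real.exp x - ∑ j ∈ Finset.range n, x ^ j / (j.factorial : ℝ)| ≤
      |x| ^ n * Real.exp |x| := by
    have := Complex.norm_exp_sub_sum_le_norm_mul_exp (x : ℂ) n
    have e : Complex.exp (x : ℂ) - ∑ m ∈ Finset.range n, (x : ℂ) ^ m / (m.factorial : ℂ) =
        ((Real.exp x - ∑ j ∈ Finset.range n, x ^ j / (j.factorial : ℝ) : ℝ) : ℂ) := by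
      push_cast; rfl
    rw [e, Complex.norm_real, Complex.norm_real] at this
    exact this
  have h2 : q ^ n ≤ (n : ℝ) ^ n * Real.exp q := by
    have h := Real.pow_div_factorial_le_exp q hq n
    rw [div_le_iff₀ (by positivity)] at h
    have h' : (n.factorial : ℝ) ≤ (n : ℝ) ^ n := by exact_mod_cast Nat.factorial_le_pow n
    calc q ^ n ≤ Real.exp q * n.factorial := h
      _ ≤ Real.exp q * (n : ℝ) ^ n := by gcongr
      _ = _ := by ring
  have h3 : |x| ≤ q := hx.trans (by nlinarith)
  calc _ ≤ |x| ^ n * Real.exp |x| := h1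
    _ ≤ (δ * q) ^ n * Real.exp q := by gcongr
    _ = δ ^ n * q ^ n * Real.exp q := by rw [mul_pow]
    _ ≤ δ ^ n * ((n : ℝ) ^ n * Real.exp q) * Real.exp q := by gcongr
    _ = _ := by rw [mul_pow, two_mul, Real.exp_add]; ring

/-! ### The density ratio of ρ-correlated Gaussian vectors -/

section

variable {κ : Type*} [Fintype κ]

/-- The part depending on `y` of the exponent of the density of `N(ρu, (1 - ρ²)I)` at `y` with
respect to `N(0, I)`. -/
noncomputable def mehlerExponent (ρ : ℝ) (u y : κ → ℝ) : ℝ :=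
  (ρ * ∑ j, u j * y j - ρ ^ 2 / 2 * ∑ j, y j ^ 2) / (1 - ρ ^ 2)

/-- The factor not depending on `y` of the density of `N(ρu, (1 - ρ²)I)` with respect to
`N(0, I)`. -/
noncomputable def mehlerFactor (ρ : ℝ) (u : κ → ℝ) : ℝ :=
  (Real.sqrt (1 - ρ ^ 2))⁻¹ ^ Fintype.card κ *
    Real.exp (-(ρ ^ 2 / (2 * (1 - ρ ^ 2)) * ∑ j, u j ^ 2))

lemma prod_shiftDensity {ρ : ℝ} (hρ : ρ ^ 2 < 1) (u y : κ → ℝ) :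
    ∏ j, shiftDensity (ρ * u j) (Real.sqrt (1 - ρ ^ 2)) (y j) =
      mehlerFactor ρ u * Real.exp (mehlerExponent ρ u y) := by
  unfold shiftDensity mehlerFactor mehlerExponent
  rw [Finset.prod_mul_distrib, Finset.prod_const, Finset.card_univ, ← Real.exp_sum, mul_assoc,
    ← Real.exp_add, Real.sq_sqrt (by linarith)]
  congr 2
  rw [Finset.mul_sum, Finset.mul_sum, Finset.mul_sum, ← Finset.sum_sub_distrib, Finset.sum_div,
    ← Finset.sum_neg_distrib, ← Finset.sum_add_distrib]
  refine Finset.sum_congr rfl fun j _ => ?_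
  have : (1 - ρ ^ 2) ≠ 0 := by linarith
  field_simp
  ring

lemma measurable_mehlerExponent (ρ : ℝ) (u : κ → ℝ) :
    Measurable (fun y => mehlerExponent ρ u y) := by
  unfold mehlerExponent; fun_prop

lemma mehlerFactor_nonneg (ρ : ℝ) (u : κ → ℝ) : 0 ≤ mehlerFactor ρ u := by
  unfold mehlerFactor; positivity

/-- Bernoulli's inequality bounds (1 - ρ²) to the power of the dimension below by 1/2; the
exponential factor is at most 1. -/
lemma mehlerFactor_le_two {ρ : ℝ} (hρ : Fintype.card κ * ρ ^ 2 ≤ 1 / 2) (hρ1 : ρ ^ 2 ≤ 1 / 2)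
    (u : κ → ℝ) : mehlerFactor ρ u ≤ 2 := by
  have h1 : 1 / 2 ≤ (1 - ρ ^ 2) ^ Fintype.card κ := by
    have := one_add_mul_le_pow (a := -ρ ^ 2) (by linarith) (Fintype.card κ)
    rw [← sub_eq_add_neg] at this
    linarith
  have h2 : 1 / 2 ≤ Real.sqrt (1 - ρ ^ 2) ^ Fintype.card κ := by
    have e : (Real.sqrt (1 - ρ ^ 2) ^ Fintype.card κ) ^ 2 = (1 - ρ ^ 2) ^ Fintype.card κ := by
      rw [← pow_mul, mul_comm, pow_mul, Real.sq_sqrt (by linarith)]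
    have : 0 ≤ Real.sqrt (1 - ρ ^ 2) ^ Fintype.card κ := by positivity
    nlinarith
  have h3 : (Real.sqrt (1 - ρ ^ 2))⁻¹ ^ Fintype.card κ ≤ 2 := by
    rw [inv_pow]
    exact inv_le_of_inv_le₀ (by norm_num) (by linarith)
  have h4 : Real.exp (-(ρ ^ 2 / (2 * (1 - ρ ^ 2)) * ∑ j, u j ^ 2)) ≤ 1 := by
    apply Real.exp_le_one_iff.2
    have : 0 ≤ 1 - ρ ^ 2 := by linarith
    have : 0 ≤ ρ ^ 2 / (2 * (1 - ρ ^ 2)) * ∑ j, u j ^ 2 := by positivity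
    linarith
  unfold mehlerFactor
  calc _ ≤ (2 : ℝ) * 1 := by gcongr
    _ = 2 := by norm_num

lemma abs_mehlerExponent_le {ρ ε : ℝ} (hρ : |ρ| ≤ ε) (hε : ε ≤ 1 / 2) (u y : κ → ℝ) :
    |mehlerExponent ρ u y| ≤ 2 * ε * (∑ j, u j ^ 2 + ∑ j, y j ^ 2) := by
  have hε0 : 0 ≤ ε := (abs_nonneg _).trans hρ
  have hsq : ρ ^ 2 ≤ ε / 2 := by
    rw [← sq_abs]; nlinarith [abs_nonneg ρ]
  have h1 : |∑ j, u j * y j| ≤ (∑ j, u j ^ 2 + ∑ j, y j ^ 2) / 2 := by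
    rw [← Finset.sum_add_distrib, Finset.sum_div]
    refine (Finset.abs_sum_le_sum_abs _ _).trans (Finset.sum_le_sum fun j _ => ?_)
    rw [abs_mul]
    nlinarith [sq_nonneg (|u j| - |y j|), sq_abs (u j), sq_abs (y j)]
  have hu : 0 ≤ ∑ j, u j ^ 2 := by positivity
  have hy : 0 ≤ ∑ j, y j ^ 2 := by positivity
  have h2 : |ρ * ∑ j, u j * y j - ρ ^ 2 / 2 * ∑ j, y j ^ 2| ≤
      ε * (∑ j, u j ^ 2 + ∑ j, y j ^ 2) := by
    calc _ ≤ |ρ * ∑ j, u j * y j| + |ρ ^ 2 / 2 * ∑ j, y j ^ 2| := abs_sub _ _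
      _ = |ρ| * |∑ j, u j * y j| + ρ ^ 2 / 2 * ∑ j, y j ^ 2 := by
        rw [abs_mul, abs_of_nonneg (by positivity : 0 ≤ ρ ^ 2 / 2 * ∑ j, y j ^ 2)]
      _ ≤ ε * ((∑ j, u j ^ 2 + ∑ j, y j ^ 2) / 2) + ε / 2 / 2 * ∑ j, y j ^ 2 := by gcongr
      _ ≤ _ := by nlinarith
  unfold mehlerExponent
  have h3 : (1 : ℝ) / 2 ≤ 1 - ρ ^ 2 := by linarith
  rw [abs_div, abs_of_nonneg (by linarith : 0 ≤ 1 - ρ ^ 2), div_le_iff₀ (by linarith)]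
  have h4 : 0 ≤ 2 * ε * (∑ j, u j ^ 2 + ∑ j, y j ^ 2) := by positivity
  nlinarith

/-- For fixed `u` this moves the correlation out of the argument of `H` into an explicit weight,
which can be expanded in powers of `mehlerExponent`. -/
lemma integral_comp_rho {T : Type*} [MeasurableSpace T] (μ : Measure T) [IsProbabilityMeasure μ]
    {ρ : ℝ} (hρ : ρ ^ 2 < 1) (u : κ → ℝ) {H : T × (κ → ℝ) → ℝ} (hH : Measurable H) :
    ∫ z, H (z.1, fun j => ρ * u j + Real.sqrt (1 - ρ ^ 2) * z.2 j) ∂(μ.prod (gaussPi κ)) =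
      ∫ z, mehlerFactor ρ u * Real.exp (mehlerExponent ρ u z.2) * H z ∂(μ.prod (gaussPi κ)) := by
  have hs : 0 < Real.sqrt (1 - ρ ^ 2) := Real.sqrt_pos.2 (by linarith)
  have hmap := gaussPi_map_affine (a := fun j => ρ * u j) hs
  simp_rw [prod_shiftDensity hρ] at hmap
  have hmeas : Measurable fun y : κ → ℝ =>
      ENNReal.ofReal (mehlerFactor ρ u * Real.exp (mehlerExponent ρ u y)) :=
    ((measurable_mehlerExponent ρ u).exp.const_mul _).ennreal_ofReal
  have hg : Measurable (fun (z : κ → ℝ) j => ρ * u j + Real.sqrt (1 - ρ ^ 2) * z j) := by fun_prop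
  have h1 := Measure.map_prod_map μ (gaussPi κ) measurable_id hg
  rw [Measure.map_id, hmap, prod_withDensity_right hmeas] at h1
  have h2 : ∫ z, H (z.1, fun j => ρ * u j + Real.sqrt (1 - ρ ^ 2) * z.2 j) ∂(μ.prod (gaussPi κ)) =
      ∫ z, H z ∂((μ.prod (gaussPi κ)).map (Prod.map id
        (fun (z : κ → ℝ) j => ρ * u j + Real.sqrt (1 - ρ ^ 2) * z j))) := by
    rw [integral_map (measurable_id.prodMap hg).aemeasurable hH.aestronglyMeasurable]
    rfl
  rw [h2, ← h1, integral_withDensity_eq_integral_toReal_smul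
    (f := fun z : T × (κ → ℝ) => ENNReal.ofReal
      (mehlerFactor ρ u * Real.exp (mehlerExponent ρ u z.2))) (hmeas.comp measurable_snd)
    (Filter.Eventually.of_forall fun z => ENNReal.ofReal_lt_top)]
  refine integral_congr_ae (Filter.Eventually.of_forall fun z => ?_)
  simp only [smul_eq_mul]
  rw [ENNReal.toReal_ofReal (mul_nonneg (mehlerFactor_nonneg _ _) (Real.exp_nonneg _))]

end

section

variable {κ : Type*} [Fintype κ]

/-- The square equals (1 - 1/(2K)) to the power -dim, so Bernoulli's inequality and dim ≤ K suffice.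
The rate 1/(4K) is what keeps the bound independent of the dimension. -/
lemma integral_exp_sum_sq_gaussPi_sq_le {K : ℕ} (hK : 1 ≤ K) (hκ : Fintype.card κ ≤ K) :
    (∫ y : κ → ℝ, Real.exp ((4 * (K : ℝ))⁻¹ * ∑ j, y j ^ 2) ∂(gaussPi κ)) ^ 2 ≤ 2 := by
  have hK' : (1 : ℝ) ≤ K := by exact_mod_cast hK
  have hc : (4 * (K : ℝ))⁻¹ ≤ 1 / 4 := by
    rw [inv_le_comm₀ (by positivity) (by norm_num)]; linarith
  rw [(integral_exp_sum_sq_gaussPi (by linarith)).2, ← pow_mul, mul_comm (Fintype.card κ), pow_mul,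
    Real.sq_sqrt (by rw [inv_nonneg]; linarith), inv_pow]
  apply inv_le_of_inv_le₀ (by norm_num)
  have h1 := one_add_mul_le_pow (a := -(2 * (4 * (K : ℝ))⁻¹)) (by linarith) (Fintype.card κ)
  rw [← sub_eq_add_neg] at h1
  have h2 : (Fintype.card κ : ℝ) * (2 * (4 * (K : ℝ))⁻¹) ≤ 1 / 2 := by
    have : (Fintype.card κ : ℝ) ≤ K := by exact_mod_cast hκ
    have e : (K : ℝ) * (2 * (4 * (K : ℝ))⁻¹) = 1 / 2 := by field_simp; norm_num
    rw [← e]; gcongr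
  linarith

variable {T : Type*} [MeasurableSpace T] {Y : Type*} [Fintype Y]

/-- If `Σ |φᵢ| ≤ 2` and the conditional moments of degree less than `2n` of the `φᵢ` along the
Gaussian vector vanish, then the `φᵢ` have small correlations along `ρ`-correlated Gaussian
vectors. -/
theorem abs_sum_integral_corr_le (μ : Measure T) [IsProbabilityMeasure μ]
    {φ : Y → T × (κ → ℝ) → ℝ} (hφ : ∀ i, Measurable (φ i)) (hφ1 : ∀ i z, |φ i z| ≤ 1)
    (hφ2 : ∀ z, ∑ i, |φ i z| ≤ 2) {n K : ℕ} (hK : 1 ≤ K) (hκ : Fintype.card κ ≤ K)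
    {ρ ε : ℝ} (hρ : |ρ| ≤ ε) (hε : 16 * K * ε ≤ 1)
    (hmom : ∀ i, ∀ j < n, ∀ (u : κ → ℝ) (ψ : T → ℝ), Measurable ψ → (∀ t, |ψ t| ≤ 1) →
      Integrable (fun z => ψ z.1 * φ i z * mehlerExponent ρ u z.2 ^ j) (μ.prod (gaussPi κ)) ∧
      ∫ z, ψ z.1 * φ i z * mehlerExponent ρ u z.2 ^ j ∂(μ.prod (gaussPi κ)) = 0) :
    |∑ i, ∫ w : (κ → ℝ) × T × (κ → ℝ), φ i (w.2.1, w.1) *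
        φ i (w.2.1, fun j => ρ * w.1 j + Real.sqrt (1 - ρ ^ 2) * w.2.2 j)
        ∂((gaussPi κ).prod (μ.prod (gaussPi κ)))| ≤ 8 * (n * (16 * K * ε)) ^ n := by
  have hK' : (1 : ℝ) ≤ K := by exact_mod_cast hK
  have hε0 : 0 ≤ ε := (abs_nonneg _).trans hρ
  have hε16 : ε ≤ 1 / 16 := by nlinarith
  have hρ1 : ρ ^ 2 ≤ ε / 16 := by rw [← sq_abs]; nlinarith [abs_nonneg ρ]
  have hρ2 : ρ ^ 2 ≤ 1 / 2 := by linarith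
  have hρ3 : Fintype.card κ * ρ ^ 2 ≤ 1 / 2 := by
    have : (Fintype.card κ : ℝ) ≤ K := by exact_mod_cast hκ
    calc _ ≤ (K : ℝ) * (ε / 16) := by gcongr
      _ ≤ 1 / 2 := by nlinarith
  set δ := 16 * K * ε with hδ
  have hδ0 : 0 ≤ δ := by positivity
  set c := (4 * (K : ℝ))⁻¹ with hc
  have hc4 : c < 1 / 2 := by
    have : (4 * (K : ℝ))⁻¹ ≤ 1 / 4 := by
      rw [inv_le_comm₀ (by positivity) (by norm_num)]; linarith
    linarith
  set N2 : (κ → ℝ) → ℝ := fun y => ∑ j, y j ^ 2 with hN2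
  have hN0 : ∀ y, 0 ≤ N2 y := fun y => by simp only [hN2]; positivity
  -- The Taylor estimate is applied with q = (|u|² + |y|²)/(8K); then exp(2q) splits into a factor
  -- in `u` and a factor in `y`, both of rate `c`.
  have htay : ∀ u y, |Real.exp (mehlerExponent ρ u y) -
      ∑ j ∈ Finset.range n, mehlerExponent ρ u y ^ j / (j.factorial : ℝ)| ≤
      (n * δ) ^ n * (Real.exp (c * N2 u) * Real.exp (c * N2 y)) := by
    intro u y
    have hx := abs_mehlerExponent_le hρ (by linarith) u y
    have e1 : 2 * ε * (∑ j, u j ^ 2 + ∑ j, y j ^ 2) = δ * ((N2 u + N2 y) / (8 * K)) := by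
      simp only [hδ, hN2]; field_simp; ring
    rw [e1] at hx
    have := abs_exp_sub_taylor_le n hδ0 hε
      (div_nonneg (add_nonneg (hN0 u) (hN0 y)) (by positivity)) hx
    rw [← Real.exp_add]
    convert this using 3
    simp only [hc]; field_simp; ring
  have hexp : Integrable (fun y : κ → ℝ => Real.exp (c * N2 y)) (gaussPi κ) :=
    (integral_exp_sum_sq_gaussPi hc4).1
  have hexpT : Integrable (fun z : T × (κ → ℝ) => Real.exp (c * N2 z.2)) (μ.prod (gaussPi κ)) :=
    hexp.comp_snd μ
  have hintT : ∫ z : T × (κ → ℝ), Real.exp (c * N2 z.2) ∂(μ.prod (gaussPi κ)) =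
      ∫ y, Real.exp (c * N2 y) ∂(gaussPi κ) := by
    rw [integral_fun_snd (fun y : κ → ℝ => Real.exp (c * N2 y))]; simp
  set I := ∫ y : κ → ℝ, Real.exp (c * N2 y) ∂(gaussPi κ) with hI
  have hI2 : I ^ 2 ≤ 2 := integral_exp_sum_sq_gaussPi_sq_le hK hκ
  have hinner : ∀ u : κ → ℝ, |∑ i, ∫ z : T × (κ → ℝ), φ i (z.1, u) *
        φ i (z.1, fun j => ρ * u j + Real.sqrt (1 - ρ ^ 2) * z.2 j) ∂(μ.prod (gaussPi κ))| ≤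
      (4 * (n * δ) ^ n * I) * Real.exp (c * N2 u) := by
    intro u
    set X := fun y => mehlerExponent ρ u y with hX
    have hXm : Measurable X := measurable_mehlerExponent ρ u
    set R := fun y => Real.exp (X y) - ∑ j ∈ Finset.range n, X y ^ j / (j.factorial : ℝ) with hR
    have hRm : Measurable R := by simp only [hR]; fun_prop
    have hφu : ∀ i, Measurable fun t => φ i (t, u) := fun i =>
      (hφ i).comp (by fun_prop)
    have hRint : ∀ i, Integrable (fun z : T × (κ → ℝ) => φ i (z.1, u) * φ i z * R z.2)
        (μ.prod (gaussPi κ)) := by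
      intro i
      refine Integrable.mono' (hexpT.const_mul ((n * δ) ^ n * Real.exp (c * N2 u)))
        (((hφu i).comp measurable_fst).mul (hφ i) |>.mul
          (hRm.comp measurable_snd)).aestronglyMeasurable
        (Filter.Eventually.of_forall fun z => ?_)
      rw [Real.norm_eq_abs, abs_mul, abs_mul]
      calc |φ i (z.1, u)| * |φ i z| * |R z.2| ≤ 1 * 1 * |R z.2| := by
            gcongr <;> exact hφ1 i _
        _ = |R z.2| := by ring
        _ ≤ _ := by rw [mul_assoc]; exact htay u z.2
    have hstep : ∀ i, ∫ z : T × (κ → ℝ), φ i (z.1, u) *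
        φ i (z.1, fun j => ρ * u j + Real.sqrt (1 - ρ ^ 2) * z.2 j) ∂(μ.prod (gaussPi κ)) =
        mehlerFactor ρ u * ∫ z : T × (κ → ℝ), φ i (z.1, u) * φ i z * R z.2
          ∂(μ.prod (gaussPi κ)) := by
      intro i
      rw [integral_comp_rho μ (by linarith) u
        (H := fun z => φ i (z.1, u) * φ i z) (by
          exact ((hφu i).comp measurable_fst).mul (hφ i)), ← integral_const_mul]
      -- With `u` frozen, t ↦ φ i (t, u) is an admissible test function ψ, so the whole Taylor
      -- polynomial integrates to zero.
      have hz : ∫ z : T × (κ → ℝ), mehlerFactor ρ u * ∑ j ∈ Finset.range n,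
          (j.factorial : ℝ)⁻¹ * (φ i (z.1, u) * φ i z * X z.2 ^ j) ∂(μ.prod (gaussPi κ)) = 0 := by
        rw [integral_const_mul, integral_finsetSum]
        · rw [Finset.sum_eq_zero, mul_zero]
          intro j hj
          rw [integral_const_mul, (hmom i j (Finset.mem_range.1 hj) u (fun t => φ i (t, u))
            (hφu i) (fun t => hφ1 i _)).2, mul_zero]
        · intro j hj
          exact (hmom i j (Finset.mem_range.1 hj) u (fun t => φ i (t, u))
            (hφu i) (fun t => hφ1 i _)).1.const_mul _
      have hzi : Integrable (fun z : T × (κ → ℝ) => mehlerFactor ρ u * ∑ j ∈ Finset.range n,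
          (j.factorial : ℝ)⁻¹ * (φ i (z.1, u) * φ i z * X z.2 ^ j)) (μ.prod (gaussPi κ)) := by
        refine Integrable.const_mul (integrable_finsetSum _ fun j hj => ?_) _
        exact (hmom i j (Finset.mem_range.1 hj) u (fun t => φ i (t, u))
            (hφu i) (fun t => hφ1 i _)).1.const_mul _
      -- The `sub_zero` rewrites cancel one another; what remains is to write the added zero as the
      -- integral `hz`, which completes the remainder `R` to the full exponential.
      rw [← sub_zero (∫ z : T × (κ → ℝ), mehlerFactor ρ u * (φ i (z.1, u) * φ i z * R z.2)
          ∂(μ.prod (gaussPi κ))), ← sub_zero (∫ z : T × (κ → ℝ), mehlerFactor ρ u *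
            Real.exp (mehlerExponent ρ u z.2) * (φ i (z.1, u) * φ i z) ∂(μ.prod (gaussPi κ))),
        sub_zero, sub_zero, ← add_zero (∫ z : T × (κ → ℝ), mehlerFactor ρ u *
          (φ i (z.1, u) * φ i z * R z.2) ∂(μ.prod (gaussPi κ))), ← hz,
        ← integral_add ((hRint i).const_mul _) hzi]
      refine integral_congr_ae (Filter.Eventually.of_forall fun z => ?_)
      simp only [hR, hX]
      have : ∑ j ∈ Finset.range n, (j.factorial : ℝ)⁻¹ *
          (φ i (z.1, u) * φ i z * mehlerExponent ρ u z.2 ^ j) = φ i (z.1, u) * φ i z *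
          ∑ j ∈ Finset.range n, mehlerExponent ρ u z.2 ^ j / (j.factorial : ℝ) := by
        rw [Finset.mul_sum]
        exact Finset.sum_congr rfl fun j _ => by ring
      rw [this]
      ring
    simp_rw [hstep]
    rw [← Finset.mul_sum, ← integral_finsetSum _ fun i _ => hRint i, abs_mul,
      abs_of_nonneg (mehlerFactor_nonneg _ _)]
    have hb : |∫ z : T × (κ → ℝ), ∑ i, φ i (z.1, u) * φ i z * R z.2 ∂(μ.prod (gaussPi κ))| ≤
        ∫ z : T × (κ → ℝ), (2 * (n * δ) ^ n * Real.exp (c * N2 u)) * Real.exp (c * N2 z.2)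
          ∂(μ.prod (gaussPi κ)) := by
      rw [← Real.norm_eq_abs]
      refine norm_integral_le_of_norm_le (hexpT.const_mul _)
        (Filter.Eventually.of_forall fun z => ?_)
      rw [Real.norm_eq_abs, ← Finset.sum_mul, abs_mul]
      have h1 : |∑ i, φ i (z.1, u) * φ i z| ≤ 2 := by
        refine (Finset.abs_sum_le_sum_abs _ _).trans (le_trans ?_ (hφ2 z))
        refine Finset.sum_le_sum fun i _ => ?_
        rw [abs_mul]
        exact mul_le_of_le_one_left (abs_nonneg _) (hφ1 i _)
      calc _ ≤ 2 * ((n * δ) ^ n * (Real.exp (c * N2 u) * Real.exp (c * N2 z.2))) := by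
            gcongr; exact htay u z.2
        _ = _ := by ring
    rw [integral_const_mul, hintT] at hb
    calc _ ≤ 2 * (2 * (n * δ) ^ n * Real.exp (c * N2 u) * I) := by
          gcongr; exact mehlerFactor_le_two hρ3 hρ2 u
      _ = _ := by ring
  have hfull : ∀ i, Integrable (fun w : (κ → ℝ) × T × (κ → ℝ) => φ i (w.2.1, w.1) *
        φ i (w.2.1, fun j => ρ * w.1 j + Real.sqrt (1 - ρ ^ 2) * w.2.2 j))
        ((gaussPi κ).prod (μ.prod (gaussPi κ))) := by
    intro i
    refine Integrable.of_bound (C := 1) ?_ (Filter.Eventually.of_forall fun w => ?_)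
    · refine (Measurable.mul ((hφ i).comp (by fun_prop))
        ((hφ i).comp (by fun_prop))).aestronglyMeasurable
    · rw [Real.norm_eq_abs, abs_mul]
      exact mul_le_one₀ (hφ1 i _) (abs_nonneg _) (hφ1 i _)
  -- Fubini: the bound for fixed `u` is integrated last, which produces a second factor `I`, and I²
  -- ≤ 2.
  have hswap : ∑ i, ∫ w : (κ → ℝ) × T × (κ → ℝ), φ i (w.2.1, w.1) *
        φ i (w.2.1, fun j => ρ * w.1 j + Real.sqrt (1 - ρ ^ 2) * w.2.2 j)
        ∂((gaussPi κ).prod (μ.prod (gaussPi κ))) =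
      ∫ u, ∑ i, ∫ z : T × (κ → ℝ), φ i (z.1, u) *
        φ i (z.1, fun j => ρ * u j + Real.sqrt (1 - ρ ^ 2) * z.2 j) ∂(μ.prod (gaussPi κ))
        ∂(gaussPi κ) := by
    rw [integral_finsetSum _ fun i _ => (hfull i).integral_prod_left]
    exact Finset.sum_congr rfl fun i _ => integral_prod _ (hfull i)
  rw [hswap, ← Real.norm_eq_abs]
  refine (norm_integral_le_of_norm_le (hexp.const_mul (4 * (n * δ) ^ n * I))
    (Filter.Eventually.of_forall fun u => by rw [Real.norm_eq_abs]; exact hinner u)).trans ?_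
  rw [integral_const_mul]
  calc 4 * (n * δ) ^ n * I * I = 4 * (n * δ) ^ n * I ^ 2 := by ring
    _ ≤ 4 * (n * δ) ^ n * 2 := by gcongr
    _ = _ := by ring

end

/-! ### Sign vectors -/

/-- The sign `±1` of a Boolean. -/
def boolSign (b : Bool) : ℝ := if b then 1 else -1

lemma boolSign_mul_self (b : Bool) : boolSign b * boolSign b = 1 := by
  cases b <;> simp [boolSign]

/-- The inner product of two sign vectors. -/
def signDot {n : ℕ} (v w : Fin n → Bool) : ℝ := ∑ l, boolSign (v l) * boolSign (w l)

/-- The exponential moment factors over the coordinates; each factor is exp x + exp(-x) whatever the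
sign of `v l`. -/
lemma sum_exp_signDot {n : ℕ} (v : Fin n → Bool) (x : ℝ) :
    ∑ w, Real.exp (x * signDot v w) = (2 * Real.cosh x) ^ n := by
  have h1 : ∀ w : Fin n → Bool, Real.exp (x * signDot v w) =
      ∏ l, Real.exp (x * (boolSign (v l) * boolSign (w l))) := by
    intro w
    rw [← Real.exp_sum, signDot, Finset.mul_sum]
  simp_rw [h1]
  rw [← Fintype.prod_sum (fun l b => Real.exp (x * (boolSign (v l) * boolSign b)))]
  have h2 : ∀ l, ∑ b, Real.exp (x * (boolSign (v l) * boolSign b)) = 2 * Real.cosh x := by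
    intro l
    rw [Fintype.sum_bool, Real.cosh_eq]
    cases v l <;> simp [boolSign] <;> ring
  rw [Finset.prod_congr rfl fun l _ => h2 l, Finset.prod_const, Finset.card_univ, Fintype.card_fin]

/-- Chernoff's bound with parameter ε, using cosh ε ≤ exp(ε²/2). -/
lemma card_signDot_gt_le {n : ℕ} (v : Fin n → Bool) {ε : ℝ} (hε : 0 ≤ ε) (σ : ℝ)
    (hσ : σ = 1 ∨ σ = -1) :
    ((Finset.univ.filter fun w => n * ε < σ * signDot v w).card : ℝ) ≤
      2 ^ n * Real.exp (-(n * ε ^ 2 / 2)) := by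
  set S := Finset.univ.filter fun w => n * ε < σ * signDot v w
  have h1 : (S.card : ℝ) * Real.exp (n * ε ^ 2) ≤ 2 ^ n * Real.exp (n * ε ^ 2 / 2) := by
    calc (S.card : ℝ) * Real.exp (n * ε ^ 2) = ∑ w ∈ S, Real.exp (n * ε ^ 2) := by simp
      _ ≤ ∑ w ∈ S, Real.exp (ε * σ * signDot v w) := by
        refine Finset.sum_le_sum fun w hw => Real.exp_le_exp.2 ?_
        have := (Finset.mem_filter.1 hw).2
        nlinarith
      _ ≤ ∑ w, Real.exp (ε * σ * signDot v w) :=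
        Finset.sum_le_sum_of_subset_of_nonneg (Finset.subset_univ _)
          fun _ _ _ => (Real.exp_pos _).le
      _ = 2 ^ n * Real.cosh (ε * σ) ^ n := by rw [sum_exp_signDot, mul_pow]
      _ = 2 ^ n * Real.cosh ε ^ n := by rcases hσ with rfl | rfl <;> simp
      _ ≤ 2 ^ n * Real.exp (ε ^ 2 / 2) ^ n := by
        gcongr
        exact Real.cosh_le_exp_half_sq ε
      _ = _ := by rw [← Real.exp_nat_mul]; congr 2; ring
  have h2 : Real.exp (n * ε ^ 2 / 2) = Real.exp (-(n * ε ^ 2 / 2)) * Real.exp (n * ε ^ 2) := by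
    rw [← Real.exp_add]; congr 1; ring
  rw [h2, ← mul_assoc] at h1
  exact le_of_mul_le_mul_right h1 (Real.exp_pos _)

lemma card_abs_signDot_gt_le {n : ℕ} (v : Fin n → Bool) {ε : ℝ} (hε : 0 ≤ ε) :
    ((Finset.univ.filter fun w => n * ε < |signDot v w|).card : ℝ) ≤
      2 * (2 ^ n * Real.exp (-(n * ε ^ 2 / 2))) := by
  have h1 := card_signDot_gt_le v hε 1 (Or.inl rfl)
  have h2 := card_signDot_gt_le v hε (-1) (Or.inr rfl)
  have h3 : (Finset.univ.filter fun w => n * ε < |signDot v w|) ⊆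
      (Finset.univ.filter fun w => n * ε < 1 * signDot v w) ∪
      (Finset.univ.filter fun w => n * ε < -1 * signDot v w) := by
    intro w hw
    simp only [Finset.mem_filter, Finset.mem_univ, true_and, Finset.mem_union, one_mul,
      neg_mul] at hw ⊢
    exact lt_abs.1 hw
  have h4 := (Finset.card_le_card h3).trans (Finset.card_union_le _ _)
  have h5 : ((Finset.univ.filter fun w => n * ε < |signDot v w|).card : ℝ) ≤ _ :=
    Nat.cast_le.2 h4
  push_cast at h5
  linarith

/-! ### Statistical dimension -/

section

variable {X : Type*} [MeasurableSpace X] {Y : Type*} [Fintype Y] {ι : Type*}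

lemma sq_integral_le {γ : Measure X} [IsProbabilityMeasure γ] {h : X → ℝ} (hi : Integrable h γ)
    (hi2 : Integrable (fun x => h x ^ 2) γ) : (∫ x, h x ∂γ) ^ 2 ≤ ∫ x, h x ^ 2 ∂γ := by
  set a := ∫ x, h x ∂γ
  have h0 : 0 ≤ ∫ x, (h x - a) ^ 2 ∂γ := integral_nonneg fun x => sq_nonneg _
  have h1 : ∀ x, (h x - a) ^ 2 = h x ^ 2 - 2 * a * h x + a ^ 2 := fun x => by ring
  simp_rw [h1] at h0
  have h2 : ∫ x, (h x ^ 2 - 2 * a * h x + a ^ 2) ∂γ =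
      ∫ x, (h x ^ 2 - 2 * a * h x) ∂γ + ∫ _, a ^ 2 ∂γ :=
    integral_add (hi2.sub (hi.const_mul _)) (integrable_const _)
  rw [h2, integral_sub hi2 (hi.const_mul _), integral_const_mul, integral_const] at h0
  simp only [probReal_univ, smul_eq_mul, one_mul] at h0
  nlinarith

/-- Cauchy–Schwarz twice: over the labels, pointwise, where the query costs the factor L, and over
x. Expanding the square of the signed sum leaves the pairwise correlations. -/
lemma sq_sum_integral_le (γ : Measure X) [IsProbabilityMeasure γ] {φ : ι → Y → X → ℝ}
    (hφ : ∀ v i, Measurable (φ v i)) (hφ1 : ∀ v i x, |φ v i x| ≤ 1) {q : X → Y → ℝ}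
    (hq : ∀ i, Measurable fun x => q x i) {L : ℝ} (hqL : ∀ x, ∑ i, q x i ^ 2 ≤ L)
    (S : Finset ι) (s : ι → ℝ) (hs : ∀ v, |s v| ≤ 1) :
    (∑ v ∈ S, s v * ∫ x, ∑ i, q x i * φ v i x ∂γ) ^ 2 ≤
      L * ∑ v ∈ S, ∑ w ∈ S, |∑ i, ∫ x, φ v i x * φ w i x ∂γ| := by
  have hL : 0 ≤ L := by
    obtain ⟨x⟩ := γ.nonempty_of_neZero
    exact (Finset.sum_nonneg fun i _ => sq_nonneg _).trans (hqL x)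
  have hq1 : ∀ x i, |q x i| ≤ L + 1 := by
    intro x i
    have h1 : q x i ^ 2 ≤ L :=
      (Finset.single_le_sum (f := fun i => q x i ^ 2) (fun i _ => sq_nonneg _)
        (Finset.mem_univ i)).trans (hqL x)
    rw [← sq_abs] at h1
    nlinarith [abs_nonneg (q x i)]
  have hqφ : ∀ v, Integrable (fun x => ∑ i, q x i * φ v i x) γ := by
    intro v
    refine integrable_finsetSum _ fun i _ => ?_
    refine Integrable.of_bound (C := L + 1) ((hq i).mul (hφ v i)).aestronglyMeasurable
      (Filter.Eventually.of_forall fun x => ?_)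
    rw [Real.norm_eq_abs, abs_mul]
    calc |q x i| * |φ v i x| ≤ (L + 1) * 1 := by gcongr; exacts [hq1 x i, hφ1 v i x]
      _ = _ := mul_one _
  have hφφ : ∀ v w i, Integrable (fun x => φ v i x * φ w i x) γ := by
    intro v w i
    refine Integrable.of_bound (C := 1) ((hφ v i).mul (hφ w i)).aestronglyMeasurable
      (Filter.Eventually.of_forall fun x => ?_)
    rw [Real.norm_eq_abs, abs_mul]
    exact mul_le_one₀ (hφ1 v i x) (abs_nonneg _) (hφ1 w i x)
  set h : X → ℝ := fun x => ∑ v ∈ S, s v * ∑ i, q x i * φ v i x with hh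
  have hhi : Integrable h γ := integrable_finsetSum _ fun v _ => (hqφ v).const_mul _
  set G : X → ℝ := fun x => ∑ v ∈ S, ∑ w ∈ S, s v * s w * ∑ i, φ v i x * φ w i x with hG
  have hGi : Integrable G γ := by
    refine integrable_finsetSum _ fun v _ => integrable_finsetSum _ fun w _ =>
      Integrable.const_mul (integrable_finsetSum _ fun i _ => hφφ v w i) _
  have hpt : ∀ x, h x ^ 2 ≤ L * G x := by
    intro x
    have e1 : h x = ∑ i, q x i * ∑ v ∈ S, s v * φ v i x := by
      simp only [hh, Finset.mul_sum]
      rw [Finset.sum_comm]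
      exact Finset.sum_congr rfl fun i _ => Finset.sum_congr rfl fun v _ => by ring
    have e2 : G x = ∑ i, (∑ v ∈ S, s v * φ v i x) ^ 2 := by
      have : ∀ i, (∑ v ∈ S, s v * φ v i x) ^ 2 =
          ∑ v ∈ S, ∑ w ∈ S, s v * s w * (φ v i x * φ w i x) := by
        intro i
        rw [sq, Finset.sum_mul_sum]
        exact Finset.sum_congr rfl fun v _ => Finset.sum_congr rfl fun w _ => by ring
      simp_rw [this, hG, Finset.mul_sum]
      rw [Finset.sum_comm (s := Finset.univ)]
      exact Finset.sum_congr rfl fun v _ => Finset.sum_comm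
    rw [e1, e2]
    refine (Finset.sum_mul_sq_le_sq_mul_sq _ _ _).trans ?_
    gcongr
    exact hqL x
  have hh2i : Integrable (fun x => h x ^ 2) γ := by
    refine Integrable.mono' (hGi.const_mul L) (hhi.aestronglyMeasurable.pow 2)
      (Filter.Eventually.of_forall fun x => ?_)
    rw [Real.norm_eq_abs, abs_of_nonneg (sq_nonneg _)]
    exact hpt x
  have e3 : ∑ v ∈ S, s v * ∫ x, ∑ i, q x i * φ v i x ∂γ = ∫ x, h x ∂γ := by
    rw [integral_finsetSum _ fun v _ => (hqφ v).const_mul _]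
    exact Finset.sum_congr rfl fun v _ => (integral_const_mul _ _).symm
  rw [e3]
  calc (∫ x, h x ∂γ) ^ 2 ≤ ∫ x, h x ^ 2 ∂γ := sq_integral_le hhi hh2i
    _ ≤ ∫ x, L * G x ∂γ := integral_mono hh2i (hGi.const_mul L) hpt
    _ = L * ∑ v ∈ S, ∑ w ∈ S, s v * s w * ∑ i, ∫ x, φ v i x * φ w i x ∂γ := by
      rw [integral_const_mul, integral_finsetSum]
      · congr 1
        refine Finset.sum_congr rfl fun v _ => ?_
        rw [integral_finsetSum]
        · refine Finset.sum_congr rfl fun w _ => ?_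
          rw [integral_const_mul, integral_finsetSum _ fun i _ => hφφ v w i]
        · exact fun w _ => Integrable.const_mul (integrable_finsetSum _ fun i _ => hφφ v w i) _
      · exact fun v _ => integrable_finsetSum _ fun w _ =>
          Integrable.const_mul (integrable_finsetSum _ fun i _ => hφφ v w i) _
    _ ≤ _ := by
      gcongr with v _ w _
      refine (le_abs_self _).trans ?_
      rw [abs_mul, abs_mul]
      exact mul_le_of_le_one_left (abs_nonneg _) (mul_le_one₀ (hs v) (abs_nonneg _) (hs w))

/-- If most pairs of a family are nearly uncorrelated, then a query has a large expectation
against few of its members. -/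
lemma card_integral_gt_le [Fintype ι] (γ : Measure X) [IsProbabilityMeasure γ]
    {φ : ι → Y → X → ℝ} (hφ : ∀ v i, Measurable (φ v i)) (hφ1 : ∀ v i x, |φ v i x| ≤ 1)
    (hφ2 : ∀ v x, ∑ i, |φ v i x| ≤ 2) {C β : ℝ} (hC : 0 ≤ C) (hβ0 : 0 ≤ β)
    (hβ : ∀ v, ((Finset.univ.filter fun w => C < |∑ i, ∫ x, φ v i x * φ w i x ∂γ|).card : ℝ) ≤ β)
    {q : X → Y → ℝ} (hq : ∀ i, Measurable fun x => q x i) {L : ℝ}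
    (hqL : ∀ x, ∑ i, q x i ^ 2 ≤ L) {θ : ℝ} (hθ : 0 ≤ θ) :
    (θ ^ 2 - L * C) *
      (Finset.univ.filter fun v => θ < |∫ x, ∑ i, q x i * φ v i x ∂γ|).card ≤ L * (2 * β) := by
  have hL : 0 ≤ L := by
    obtain ⟨x⟩ := γ.nonempty_of_neZero
    exact (Finset.sum_nonneg fun i _ => sq_nonneg _).trans (hqL x)
  set S := Finset.univ.filter fun v => θ < |∫ x, ∑ i, q x i * φ v i x ∂γ| with hS
  set c : ι → ℝ := fun v => ∫ x, ∑ i, q x i * φ v i x ∂γ with hc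
  set r : ι → ι → ℝ := fun v w => |∑ i, ∫ x, φ v i x * φ w i x ∂γ| with hr
  have hr2 : ∀ v w, r v w ≤ 2 := by
    intro v w
    have hφφ : ∀ i, Integrable (fun x => φ v i x * φ w i x) γ := by
      intro i
      refine Integrable.of_bound (C := 1) ((hφ v i).mul (hφ w i)).aestronglyMeasurable
        (Filter.Eventually.of_forall fun x => ?_)
      rw [Real.norm_eq_abs, abs_mul]
      exact mul_le_one₀ (hφ1 v i x) (abs_nonneg _) (hφ1 w i x)
    simp only [hr]
    rw [← integral_finsetSum _ fun i _ => hφφ i, ← Real.norm_eq_abs]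
    refine (norm_integral_le_of_norm_le (integrable_const (2 : ℝ))
      (Filter.Eventually.of_forall fun x => ?_)).trans (by simp)
    rw [Real.norm_eq_abs]
    refine (Finset.abs_sum_le_sum_abs _ _).trans (le_trans ?_ (hφ2 w x))
    refine Finset.sum_le_sum fun i _ => ?_
    rw [abs_mul]
    exact mul_le_of_le_one_left (abs_nonneg _) (hφ1 v i x)
  -- Weighting by the signs of the expectations turns the individual lower bounds into a lower bound
  -- for one linear combination.
  have h1 : θ * S.card ≤ ∑ v ∈ S, SignType.sign (c v) * c v := by
    calc θ * S.card = ∑ v ∈ S, θ := by simp [mul_comm]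
      _ ≤ _ := Finset.sum_le_sum fun v hv => by
        rw [sign_mul_self]
        exact (Finset.mem_filter.1 hv).2.le
  have h2 := sq_sum_integral_le γ hφ hφ1 hq hqL S (fun v => ((SignType.sign (c v) : SignType) : ℝ))
    (fun v => by cases SignType.sign (c v) <;> simp)
  have h3 : ∀ v, ∑ w ∈ S, r v w ≤ S.card * C + 2 * β := by
    intro v
    -- Pairs that are not nearly uncorrelated are paid for with the trivial bound 2; there are at
    -- most β of them for each `v`.
    have h4 : ∀ w, r v w ≤ C + if C < r v w then 2 else 0 := by
      intro w
      split_ifs with h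
      · linarith [hr2 v w]
      · linarith [not_lt.1 h]
    calc ∑ w ∈ S, r v w ≤ ∑ w ∈ S, (C + if C < r v w then 2 else 0) :=
          Finset.sum_le_sum fun w _ => h4 w
      _ = S.card * C + ∑ w ∈ S, (if C < r v w then (2 : ℝ) else 0) := by
          rw [Finset.sum_add_distrib]; simp
      _ ≤ S.card * C + ∑ w, (if C < r v w then (2 : ℝ) else 0) := by
          refine add_le_add_right (Finset.sum_le_sum_of_subset_of_nonneg (Finset.subset_univ S)
            fun w _ _ => ?_) _
          split_ifs <;> norm_num
      _ ≤ _ := by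
          rw [← Finset.sum_filter, Finset.sum_const, nsmul_eq_mul, mul_comm _ (2 : ℝ)]
          gcongr
          exact hβ v
  -- Dividing this by |S| gives the claim; the empty set is treated apart.
  have h5 : (θ * S.card) ^ 2 ≤ L * (S.card * (S.card * C + 2 * β)) := by
    calc (θ * S.card) ^ 2 ≤ (∑ v ∈ S, SignType.sign (c v) * c v) ^ 2 := by
          gcongr
      _ ≤ _ := h2
      _ ≤ L * ∑ v ∈ S, (S.card * C + 2 * β) := by
          gcongr with v hv
          exact h3 v
      _ = _ := by rw [Finset.sum_const, nsmul_eq_mul]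
  rcases Nat.eq_zero_or_pos S.card with h0 | h0
  · rw [h0] at h5 ⊢
    simp only [Nat.cast_zero, mul_zero]; positivity
  · have h6 : (0 : ℝ) < S.card := by exact_mod_cast h0
    refine le_of_mul_le_mul_left ?_ h6
    nlinarith

end

/-! ### Running an algorithm against an uninformative oracle -/

namespace SQLower

/-- If, for each query, all but `β` of the oracles `O v` give the same answer `E q` to it, then all
but `N * β` of the runs with at most `N` queries have the same output. -/
lemma exists_common_result {X : Type*} [MeasurableSpace X] {H : Type*} [Nonempty H] {ι : Type*}
    (O : ι → StatQuery X → ℝ → ℝ) (E : StatQuery X → ℝ) (bad : StatQuery X → Finset ι)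
    {θ : ℝ} (hO : ∀ v q a, 0 < a → a < θ → v ∉ bad q → O v q a = E q) {β : ℕ}
    (hbad : ∀ q, (bad q).card ≤ β) (N : ℕ) (B : SQAlg X H) :
    ∃ (h : H) (S : Finset ι), S.card ≤ N * β ∧ ∀ v ∉ S, B.numQueries (O v) ≤ N →
      (∀ s ∈ B.accuracies (O v), s < θ) → B.result (O v) = h := by
  classical
  induction N generalizing B with
  | zero =>
    cases B with
    | output h => exact ⟨h, ∅, by simp, fun v _ _ _ => rfl⟩
    | query q a ha next =>
      -- The output chosen here is irrelevant: a run that starts with a query has more than 0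
      -- queries.
      exact ⟨Classical.arbitrary H, ∅, by simp, fun v _ h => by
        simp [SQAlg.numQueries, SQAlg.accuracies] at h⟩
  | succ N ih =>
    cases B with
    | output h => exact ⟨h, ∅, by simp, fun v _ _ _ => rfl⟩
    | query q a ha next =>
      -- Only the branch after the answer `E q` is followed; indices whose oracle answers otherwise
      -- are discarded into `bad q`.
      obtain ⟨h, S, hS, hh⟩ := ih (next (E q))
      refine ⟨h, S ∪ bad q, ?_, fun v hv hN hs => ?_⟩
      · calc _ ≤ S.card + (bad q).card := Finset.card_union_le _ _
          _ ≤ N * β + β := add_le_add hS (hbad q)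
          _ = _ := by ring
      · simp only [Finset.mem_union, not_or] at hv
        simp only [SQAlg.numQueries, SQAlg.accuracies, List.length_cons, List.mem_cons,
          forall_eq_or_imp, add_le_add_iff_right] at hN hs
        have e := hO v q a ha hs.1 hv.2
        rw [e] at hN hs
        rw [SQAlg.result, e]
        exact hh v hv.1 hN hs.2

end SQLower

/-- Among finitely many events of probability at least `p`, a proportion `p` occurs
simultaneously, outside of any null set. -/
lemma exists_card_filter_mem_ge {Ω : Type*} [MeasurableSpace Ω] (P : Measure Ω)
    [IsProbabilityMeasure P] {ι : Type*} [Fintype ι] (S : ι → Set Ω)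
    (hS : ∀ v, MeasurableSet (S v)) {p : ℝ} (hp : ∀ v, p ≤ P.real (S v)) {G : Ω → Prop}
    (hG : ∀ᵐ ω ∂P, G ω) :
    ∃ (ω : Ω) (T : Finset ι), G ω ∧ (∀ v ∈ T, ω ∈ S v) ∧ p * Fintype.card ι ≤ T.card := by
  classical
  have hi : ∀ v, Integrable ((S v).indicator fun _ => (1 : ℝ)) P := fun v =>
    (integrable_const 1).indicator (hS v)
  -- The number of events that occur reaches its mean at some point outside the null set.
  obtain ⟨ω, hω, h⟩ := exists_notMem_null_integral_le (μ := P) (N := {ω | ¬ G ω})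
    (f := fun ω => ∑ v, (S v).indicator (fun _ => (1 : ℝ)) ω)
    (integrable_finsetSum _ fun v _ => hi v) hG
  refine ⟨ω, Finset.univ.filter fun v => ω ∈ S v, by simpa using hω, by simp, ?_⟩
  rw [integral_finsetSum _ fun v _ => hi v] at h
  simp_rw [integral_indicator_const _ (hS _)] at h
  calc p * Fintype.card ι = ∑ v : ι, p := by simp [mul_comm]
    _ ≤ ∑ v, P.real (S v) • (1 : ℝ) := Finset.sum_le_sum fun v _ => by simpa using hp v
    _ ≤ _ := h
    _ = _ := by simp [Set.indicator_apply]

/-! ### Orthonormal frames -/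

section

variable {E : Type*} [NormedAddCommGroup E] [InnerProductSpace ℝ E]

lemma orthonormal_sumElim {ι κ : Type*} {v : ι → E} {w : κ → E} (hv : Orthonormal ℝ v)
    (hw : Orthonormal ℝ w) (h : ∀ i j, ⟪v i, w j⟫ = 0) : Orthonormal ℝ (Sum.elim v w) := by
  classical
  rw [orthonormal_iff_ite] at *
  rintro (i | i) (j | j)
  · simpa using hv i j
  · simpa using h i j
  · simpa [real_inner_comm] using h j i
  · simpa using hw i j

/-- The vectors `n^{-1/2} ∑ₗ vₗ e_{j,l}` for a sign vector `v`. -/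
noncomputable def signFrame {κ : Type*} {n : ℕ} (e : κ × Fin n → E) (v : Fin n → Bool) (j : κ) :
    E :=
  (Real.sqrt n)⁻¹ • ∑ l, boolSign (v l) • e (j, l)

variable {κ : Type*} {n : ℕ} {e : κ × Fin n → E}

/-- Different indices use disjoint blocks, and equal indices give the same value in every block.
Hence the cross Gram matrix is a scalar matrix, and a pair of frames is described by one correlation
ρ. -/
lemma inner_signFrame [DecidableEq κ] (he : Orthonormal ℝ e) (v w : Fin n → Bool) (i j : κ) :
    ⟪signFrame e v i, signFrame e w j⟫ = if i = j then signDot v w / n else 0 := by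
  classical
  have h1 : ∀ l m, ⟪e (i, l), e (j, m)⟫ = if i = j ∧ l = m then (1 : ℝ) else 0 := by
    intro l m
    rw [orthonormal_iff_ite.1 he]
    simp
  simp only [signFrame, inner_smul_left, inner_smul_right, sum_inner, inner_sum, h1]
  split_ifs with hij
  · simp only [hij, true_and, mul_ite, mul_one, mul_zero, Finset.sum_ite_eq',
      Finset.mem_univ, if_true, signDot, RCLike.conj_to_real]
    rw [div_eq_inv_mul, ← Real.mul_self_sqrt (Nat.cast_nonneg n), mul_inv, mul_assoc,
      Real.mul_self_sqrt (Nat.cast_nonneg n), Finset.mul_sum, Finset.mul_sum, Finset.mul_sum]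
    exact Finset.sum_congr rfl fun _ _ => by ring
  · simp [hij]

lemma orthonormal_signFrame (he : Orthonormal ℝ e) (hn : 0 < n) (v : Fin n → Bool) :
    Orthonormal ℝ (signFrame e v) := by
  classical
  rw [orthonormal_iff_ite]
  intro i j
  rw [inner_signFrame he]
  have : signDot v v / n = 1 := by
    have : (n : ℝ) ≠ 0 := by positivity
    simp only [signDot, boolSign_mul_self]
    simp [this]
  rw [this]

lemma inner_signFrame_right_eq_zero {x : E} (hx : ∀ p, ⟪x, e p⟫ = 0) (v : Fin n → Bool) (j : κ) :
    ⟪x, signFrame e v j⟫ = 0 := by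
  simp [signFrame, inner_smul_right, inner_sum, hx]

/-- The normalized component of the frame of `w` orthogonal to the frame of `v`. -/
noncomputable def residualFrame (e : κ × Fin n → E) (v w : Fin n → Bool) (j : κ) : E :=
  (Real.sqrt (1 - (signDot v w / n) ^ 2))⁻¹ •
    (signFrame e w j - (signDot v w / n) • signFrame e v j)

lemma inner_signFrame_residualFrame (he : Orthonormal ℝ e) (hn : 0 < n) (v w : Fin n → Bool)
    (i j : κ) : ⟪signFrame e v i, residualFrame e v w j⟫ = 0 := by
  classical
  rw [residualFrame, inner_smul_right, inner_sub_right, inner_smul_right, inner_signFrame he,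
    orthonormal_iff_ite.1 (orthonormal_signFrame he hn v)]
  split_ifs <;> simp

lemma orthonormal_residualFrame (he : Orthonormal ℝ e) (hn : 0 < n) {v w : Fin n → Bool}
    (hvw : (signDot v w / n) ^ 2 < 1) : Orthonormal ℝ (residualFrame e v w) := by
  classical
  rw [orthonormal_iff_ite]
  intro i j
  have hs : Real.sqrt (1 - (signDot v w / n) ^ 2) * Real.sqrt (1 - (signDot v w / n) ^ 2) =
      1 - (signDot v w / n) ^ 2 := Real.mul_self_sqrt (by linarith)
  have hs0 : Real.sqrt (1 - (signDot v w / n) ^ 2) ≠ 0 := (Real.sqrt_pos.2 (by linarith)).ne'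
  conv_lhs => rw [residualFrame]
  rw [inner_smul_left, inner_sub_left, inner_smul_left, inner_signFrame_residualFrame he hn,
    mul_zero, sub_zero, residualFrame, inner_smul_right, inner_sub_right, inner_smul_right,
    orthonormal_iff_ite.1 (orthonormal_signFrame he hn w), real_inner_comm, inner_signFrame he]
  simp only [RCLike.conj_to_real, eq_comm (a := j)]
  split_ifs
  · rw [← mul_assoc, ← mul_inv, hs, ← sq]
    exact inv_mul_cancel₀ (by linarith)
  · simp

lemma coords_signFrame_eq {v w : Fin n → Bool}
    (hvw : (signDot v w / n) ^ 2 < 1) (x : E) :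
    coords (signFrame e w) x = fun j => (signDot v w / n) * coords (signFrame e v) x j +
      Real.sqrt (1 - (signDot v w / n) ^ 2) * coords (residualFrame e v w) x j := by
  have hs0 : Real.sqrt (1 - (signDot v w / n) ^ 2) ≠ 0 := (Real.sqrt_pos.2 (by linarith)).ne'
  ext j
  simp only [coords, residualFrame, inner_smul_left, inner_sub_left, RCLike.conj_to_real]
  rw [← mul_assoc, mul_inv_cancel₀ hs0]
  ring

/-- The joint law of the coordinates in two frames and in a family orthogonal to both. -/
lemma map_coords_triple [MeasurableSpace E] [BorelSpace E] [FiniteDimensional ℝ E]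
    {ι : Type*} [Fintype ι] [Fintype κ] {t : ι → E} (ht : Orthonormal ℝ t)
    (he : Orthonormal ℝ e) (hte : ∀ i p, ⟪t i, e p⟫ = 0) (hn : 0 < n) {v w : Fin n → Bool}
    (hvw : (signDot v w / n) ^ 2 < 1) :
    (stdGaussian E).map (fun x => (coords (signFrame e v) x, coords t x,
      coords (residualFrame e v w) x)) = (gaussPi κ).prod ((gaussPi ι).prod (gaussPi κ)) := by
  have h0 : ∀ i j, ⟪t i, residualFrame e v w j⟫ = 0 := by
    intro i j
    rw [residualFrame, inner_smul_right, inner_sub_right, inner_smul_right,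
      inner_signFrame_right_eq_zero (hte i), inner_signFrame_right_eq_zero (hte i)]
    simp
  have h1 : Orthonormal ℝ (Sum.elim (signFrame e v) (Sum.elim t (residualFrame e v w))) := by
    refine orthonormal_sumElim (orthonormal_signFrame he hn v)
      (orthonormal_sumElim ht (orthonormal_residualFrame he hn hvw) h0) ?_
    rintro i (j | j)
    · rw [Sum.elim_inl, real_inner_comm]
      exact inner_signFrame_right_eq_zero (hte j) v i
    · exact inner_signFrame_residualFrame he hn v w i j
  have h2 := map_coords_prod_stdGaussian h1
  have h3 := (measurePreserving_sumPiEquivProdPi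
    (fun _ : ι ⊕ κ => gaussianReal 0 1)).map_eq
  unfold gaussPi at h2 ⊢
  rw [← h3, ← Measure.map_id (μ := Measure.pi fun _ : κ => gaussianReal 0 1),
    Measure.map_prod_map _ _ measurable_id (by fun_prop), ← h2,
    Measure.map_map (by fun_prop) (by fun_prop)]
  rfl

end

/-! ### Visible and hidden subspaces, and members of the rotated family -/

namespace SQLower

variable {d : ℕ}

/-- An orthonormal basis of a subspace, as vectors of the ambient space. -/
noncomputable def subBasis (S : Submodule ℝ (Eu d)) (i : Fin (Module.finrank ℝ S)) : Eu d :=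
  stdOrthonormalBasis ℝ S i

lemma orthonormal_subBasis (S : Submodule ℝ (Eu d)) : Orthonormal ℝ (subBasis S) :=
  (stdOrthonormalBasis ℝ S).orthonormal.comp_linearIsometry S.subtypeₗᵢ

lemma subBasis_mem (S : Submodule ℝ (Eu d)) (i : Fin (Module.finrank ℝ S)) : subBasis S i ∈ S :=
  (stdOrthonormalBasis ℝ S i).2

lemma sum_coords_subBasis (S : Submodule ℝ (Eu d)) (x : Eu d) :
    ∑ i, coords (subBasis S) x i • subBasis S i = S.starProjection x := by
  have h := congrArg (Subtype.val) ((stdOrthonormalBasis ℝ S).sum_repr' (S.orthogonalProjectionOnto x))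
  rw [S.starProjection_apply, ← h]
  simp only [Submodule.coe_sum, Submodule.coe_smul]
  refine Finset.sum_congr rfl fun i _ => ?_
  rw [Submodule.inner_orthogonalProjectionOnto_eq_of_mem_left]
  rfl

lemma coords_subBasis_starProjection {S T : Submodule ℝ (Eu d)} (h : S ≤ T) (x : Eu d) :
    coords (subBasis S) (T.starProjection x) = coords (subBasis S) x := by
  ext i
  simp only [coords]
  rw [← Submodule.inner_starProjection_left_eq_right,
    Submodule.starProjection_eq_self_iff.2 (h (subBasis_mem S i))]

/-- The projection of `W` onto `V`. -/
noncomputable def visibleSubspace (V W : Submodule ℝ (Eu d)) : Submodule ℝ (Eu d) :=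
  W.map (V.starProjection : Eu d →ₗ[ℝ] Eu d)

variable (V W : Submodule ℝ (Eu d))

lemma visibleSubspace_le : visibleSubspace V W ≤ V := by
  rintro _ ⟨x, -, rfl⟩
  exact V.starProjection_apply_mem x

lemma hiddenSubspace_le : hiddenSubspace V W ≤ Vᗮ := inf_le_right

lemma finrank_visibleSubspace_le :
    Module.finrank ℝ (visibleSubspace V W) ≤ Module.finrank ℝ W :=
  Submodule.finrank_map_le _ _

lemma starProjection_orthogonal_mem_hiddenSubspace {w : Eu d} (hw : w ∈ W) :
    Vᗮ.starProjection w ∈ hiddenSubspace V W := by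
  refine ⟨?_, Submodule.starProjection_apply_mem _ _⟩
  rw [Submodule.starProjection_orthogonal_val]
  exact sub_mem (Submodule.mem_sup_right hw)
    (Submodule.mem_sup_left (V.starProjection_apply_mem w))

/-- The projection to `Vᗮ` kills `V` and fixes `hiddenSubspace V W`, so every hidden vector is the
projection of its component in `W`. -/
lemma finrank_hiddenSubspace_le :
    Module.finrank ℝ (hiddenSubspace V W) ≤ Module.finrank ℝ W := by
  refine (Submodule.finrank_mono ?_).trans
    (Submodule.finrank_map_le (Vᗮ.starProjection : Eu d →ₗ[ℝ] Eu d) W)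
  rintro x ⟨hx, hx'⟩
  obtain ⟨v, hv, w, hw, rfl⟩ := Submodule.mem_sup.1 hx
  refine ⟨w, hw, ?_⟩
  have h1 := Submodule.starProjection_eq_self_iff.2 hx'
  rw [map_add, (Submodule.starProjection_apply_eq_zero_iff _).2
    (V.le_orthogonal_orthogonal hv), zero_add] at h1
  exact h1

lemma inner_visible_hidden {x y : Eu d} (hx : x ∈ visibleSubspace V W)
    (hy : y ∈ hiddenSubspace V W) : ⟪x, y⟫ = 0 :=
  (Submodule.mem_orthogonal V y).1 (hiddenSubspace_le V W hy) x (visibleSubspace_le V W hx)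

/-- Every vector of `W` is the sum of its projection to `V`, which is visible, and its projection to
`Vᗮ`, which is hidden. So the two kinds of coordinates determine x^W. -/
lemma apply_eq_of_starProjection_eq {Y : Type*} {f : Eu d → Y}
    (hf : ∀ x, f x = f (W.starProjection x)) {x y : Eu d}
    (h1 : ∀ t ∈ visibleSubspace V W, ⟪t, x⟫ = ⟪t, y⟫)
    (h2 : ∀ u ∈ hiddenSubspace V W, ⟪u, x⟫ = ⟪u, y⟫) : f x = f y := by
  have h : W.starProjection (x - y) = 0 := by
    rw [Submodule.starProjection_apply_eq_zero_iff, Submodule.mem_orthogonal]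
    intro w hw
    have hv : V.starProjection w ∈ visibleSubspace V W := ⟨w, hw, rfl⟩
    have e := Submodule.starProjection_add_starProjection_orthogonal (K := V) w
    rw [← e, inner_add_left, inner_sub_right, inner_sub_right, h1 _ hv,
      h2 _ (starProjection_orthogonal_mem_hiddenSubspace V W hw)]
    simp
  rw [map_sub, sub_eq_zero] at h
  rw [hf x, hf y, h]

/-- The vector with given coordinates in the visible and the hidden subspace. -/
noncomputable def assemble (z : (Fin (Module.finrank ℝ (visibleSubspace V W)) → ℝ) ×
    (Fin (Module.finrank ℝ (hiddenSubspace V W)) → ℝ)) : Eu d :=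
  ∑ i, z.1 i • subBasis (visibleSubspace V W) i + ∑ j, z.2 j • subBasis (hiddenSubspace V W) j

lemma measurable_assemble : Measurable (assemble V W) := by
  unfold assemble; fun_prop

lemma inner_assemble_visible (x : Eu d) (y : Fin (Module.finrank ℝ (hiddenSubspace V W)) → ℝ)
    {t : Eu d} (ht : t ∈ visibleSubspace V W) :
    ⟪t, assemble V W (coords (subBasis (visibleSubspace V W)) x, y)⟫ = ⟪t, x⟫ := by
  rw [assemble, inner_add_right, sum_coords_subBasis,
    ← Submodule.inner_starProjection_left_eq_right, Submodule.starProjection_eq_self_iff.2 ht,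
    inner_sum, Finset.sum_eq_zero, add_zero]
  intro j _
  rw [inner_smul_right, inner_visible_hidden V W ht (subBasis_mem _ j), mul_zero]

lemma inner_assemble_hidden (x : Fin (Module.finrank ℝ (visibleSubspace V W)) → ℝ)
    (y : Fin (Module.finrank ℝ (hiddenSubspace V W)) → ℝ)
    {u : Eu d} (hu : u ∈ hiddenSubspace V W) :
    ⟪u, assemble V W (x, y)⟫ = ⟪u, ∑ j, y j • subBasis (hiddenSubspace V W) j⟫ := by
  rw [assemble, inner_add_right, inner_sum, Finset.sum_eq_zero, zero_add]
  intro j _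
  rw [inner_smul_right, real_inner_comm, inner_visible_hidden V W (subBasis_mem _ j) hu, mul_zero]

lemma apply_assemble {Y : Type*} {f : Eu d → Y} (hf : ∀ x, f x = f (W.starProjection x))
    (x : Eu d) : f (assemble V W (coords (subBasis (visibleSubspace V W)) x,
      coords (subBasis (hiddenSubspace V W)) x)) = f x := by
  refine apply_eq_of_starProjection_eq V W hf
    (fun t ht => inner_assemble_visible V W x _ ht) fun u hu => ?_
  rw [inner_assemble_hidden V W _ _ hu, sum_coords_subBasis,
    ← Submodule.inner_starProjection_left_eq_right, Submodule.starProjection_eq_self_iff.2 hu]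

/-- The functions obtained by replacing the hidden coordinates by the coordinates in an
orthonormal frame orthogonal to the visible subspace belong to the rotated family. -/
lemma apply_assemble_mem_rotatedFamily {Y : Type*} {f : Eu d → Y}
    (hf : ∀ x, f x = f (W.starProjection x))
    {w : Fin (Module.finrank ℝ (hiddenSubspace V W)) → Eu d} (hw : Orthonormal ℝ w)
    (hw' : ∀ t ∈ visibleSubspace V W, ∀ j, ⟪t, w j⟫ = 0) :
    (fun x => f (assemble V W (coords (subBasis (visibleSubspace V W)) x, coords w x))) ∈
      rotatedFamily f V W := by
  set b := stdOrthonormalBasis ℝ (hiddenSubspace V W) with hb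
  let Q : Eu d →ₗ[ℝ] hiddenSubspace V W :=
    ∑ j, (innerₛₗ ℝ (w j)).smulRight (b j)
  let R : hiddenSubspace V W →ₗ[ℝ] Eu d :=
    ∑ j, (innerₛₗ ℝ (b j)).smulRight (w j)
  have hQ : ∀ x, Q x = ∑ j, ⟪w j, x⟫ • b j := fun x => by simp [Q]
  have hR : ∀ x, R x = ∑ j, ⟪b j, x⟫ • w j := fun x => by simp [R]
  have hQc : ∀ x, (Q x : Eu d) = ∑ j, coords w x j • subBasis (hiddenSubspace V W) j := by
    intro x
    rw [hQ, Submodule.coe_sum]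
    rfl
  have hadj : R = LinearMap.adjoint Q := by
    rw [LinearMap.eq_adjoint_iff]
    intro x y
    rw [hQ, hR, sum_inner, inner_sum]
    refine Finset.sum_congr rfl fun j _ => ?_
    rw [real_inner_smul_left]
    refine Eq.trans ?_ (real_inner_smul_right x (b j) _).symm
    rw [real_inner_comm x (b j), mul_comm]
  refine ⟨Q, ?_, ?_, ?_⟩
  · rw [← hadj]
    ext1 x
    rw [LinearMap.comp_apply, hQ, LinearMap.id_apply]
    conv_rhs => rw [← b.sum_repr' x]
    refine Finset.sum_congr rfl fun j _ => ?_
    congr 1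
    rw [hR]
    exact hw.inner_right_fintype _ j
  · intro x hx
    rw [hQ]
    refine Finset.sum_eq_zero fun j _ => ?_
    have hx' : V.starProjection x ∈ visibleSubspace V W := ⟨x, hx, rfl⟩
    rw [real_inner_comm, hw' _ hx' j, zero_smul]
  · ext1 x
    have hperp : ∀ t ∈ visibleSubspace V W, t ∈ (hiddenSubspace V W)ᗮ := fun t ht =>
      (Submodule.mem_orthogonal' _ _).2 fun u hu => inner_visible_hidden V W ht hu
    refine apply_eq_of_starProjection_eq V W hf (fun t ht => ?_) fun u hu => ?_
    · rw [inner_assemble_visible V W x _ ht, inner_add_right,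
        inner_visible_hidden V W ht (Q x).2, add_zero,
        ← Submodule.inner_starProjection_left_eq_right,
        Submodule.starProjection_eq_self_iff.2 (hperp t ht)]
    · rw [inner_assemble_hidden V W _ _ hu, inner_add_right, hQc,
        (Submodule.mem_orthogonal _ _).1 (Submodule.starProjection_apply_mem _ x) u hu, zero_add]

/-- There are orthonormal families in the orthogonal complement of a subspace of small
dimension. -/
lemma exists_orthonormal_orthogonal (S : Submodule ℝ (Eu d)) {k n : ℕ}
    (h : k * n + Module.finrank ℝ S ≤ d) :
    ∃ e : Fin k × Fin n → Eu d, Orthonormal ℝ e ∧ ∀ t ∈ S, ∀ p, ⟪t, e p⟫ = 0 := by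
  have h1 := Submodule.finrank_add_finrank_orthogonal S
  rw [finrank_euclideanSpace_fin] at h1
  have h2 : Fintype.card (Fin k × Fin n) ≤ Fintype.card (Fin (Module.finrank ℝ Sᗮ)) := by
    simp; omega
  obtain ⟨g⟩ := Function.Embedding.nonempty_of_card_le h2
  exact ⟨subBasis Sᗮ ∘ g, (orthonormal_subBasis Sᗮ).comp g g.injective, fun t ht p =>
    (Submodule.mem_orthogonal S _).1 (subBasis_mem Sᗮ (g p)) t ht⟩

end SQLower

/-! ### Labels depending on a pair of random variables -/

section

variable {T : Type*} [MeasurableSpace T] {κ : Type*} [Fintype κ]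
  {Y : Type*} [Fintype Y] [MeasurableSpace Y] [DiscreteMeasurableSpace Y]
  (η : Kernel (T × (κ → ℝ)) Y)

/-- The conditional probability of the label `i`. -/
noncomputable def labelProb (i : Y) (z : T × (κ → ℝ)) : ℝ := (η z).real {i}

/-- The conditional probability of the label `i` after averaging over the Gaussian component. -/
noncomputable def meanLabelProb (i : Y) (t : T) : ℝ := ∫ u, labelProb η i (t, u) ∂(gaussPi κ)

/-- The deviation of the conditional probability of a label from its average. -/
noncomputable def labelDev (i : Y) (z : T × (κ → ℝ)) : ℝ :=
  labelProb η i z - meanLabelProb η i z.1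

lemma measurable_labelProb (i : Y) : Measurable (labelProb η i) :=
  (η.measurable_coe (MeasurableSet.singleton i)).ennreal_toReal

lemma labelProb_nonneg (i : Y) (z : T × (κ → ℝ)) : 0 ≤ labelProb η i z := measureReal_nonneg

lemma meanLabelProb_nonneg (i : Y) (t : T) : 0 ≤ meanLabelProb η i t :=
  integral_nonneg fun _ => labelProb_nonneg η i _

lemma measurable_meanLabelProb (i : Y) : Measurable (meanLabelProb η i) :=
  ((measurable_labelProb η i).stronglyMeasurable.integral_prod_right'
    (ν := gaussPi κ)).measurable

lemma measurable_labelDev (i : Y) : Measurable (labelDev η i) :=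
  (measurable_labelProb η i).sub ((measurable_meanLabelProb η i).comp measurable_fst)

variable [IsMarkovKernel η]

lemma labelProb_le_one (i : Y) (z : T × (κ → ℝ)) : labelProb η i z ≤ 1 := measureReal_le_one

lemma sum_labelProb (z : T × (κ → ℝ)) : ∑ i, labelProb η i z = 1 := by
  unfold labelProb
  rw [sum_measureReal_singleton, Finset.coe_univ, probReal_univ]

lemma integrable_labelProb_right (i : Y) (t : T) :
    Integrable (fun u => labelProb η i (t, u)) (gaussPi κ) :=
  Integrable.of_bound (C := 1)
    ((measurable_labelProb η i).comp measurable_prodMk_left).aestronglyMeasurable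
    (Filter.Eventually.of_forall fun z => by
      rw [Real.norm_eq_abs, abs_of_nonneg (labelProb_nonneg η i _)]; exact labelProb_le_one η i _)

lemma sum_meanLabelProb (t : T) : ∑ i, meanLabelProb η i t = 1 := by
  unfold meanLabelProb
  rw [← integral_finsetSum _ fun i _ => integrable_labelProb_right η i t]
  simp [sum_labelProb]

lemma meanLabelProb_le_one (i : Y) (t : T) : meanLabelProb η i t ≤ 1 := by
  rw [← sum_meanLabelProb η t]
  exact Finset.single_le_sum (fun j _ => meanLabelProb_nonneg η j t) (Finset.mem_univ i)

lemma abs_labelDev_le_one (i : Y) (z : T × (κ → ℝ)) : |labelDev η i z| ≤ 1 := by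
  rw [labelDev, abs_le]
  constructor <;> linarith [labelProb_nonneg η i z, labelProb_le_one η i z,
    meanLabelProb_nonneg η i z.1, meanLabelProb_le_one η i z.1]

lemma sum_abs_labelDev_le_two (z : T × (κ → ℝ)) : ∑ i, |labelDev η i z| ≤ 2 := by
  calc ∑ i, |labelDev η i z| ≤ ∑ i, (labelProb η i z + meanLabelProb η i z.1) := by
        refine Finset.sum_le_sum fun i _ => (abs_sub _ _).trans_eq ?_
        rw [abs_of_nonneg (labelProb_nonneg η i z), abs_of_nonneg (meanLabelProb_nonneg η i z.1)]
    _ = 2 := by rw [Finset.sum_add_distrib, sum_labelProb, sum_meanLabelProb]; norm_num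

lemma sum_labelDev (z : T × (κ → ℝ)) : ∑ i, labelDev η i z = 0 := by
  unfold labelDev
  rw [Finset.sum_sub_distrib, sum_labelProb, sum_meanLabelProb, sub_self]

variable {E : Type*} [MeasurableSpace E]

/-- The distribution of labelled examples `(x, y)` with `x ∼ γ` and `y ∼ η (X x)`. -/
noncomputable def plantedMeasure (γ : Measure E) {X : E → T × (κ → ℝ)} (hX : Measurable X) :
    Measure (E × Y) := γ ⊗ₘ η.comap X hX

variable (γ : Measure E) [IsProbabilityMeasure γ] {X : E → T × (κ → ℝ)} (hX : Measurable X)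

instance : IsProbabilityMeasure (plantedMeasure η γ hX) := by
  unfold plantedMeasure; infer_instance

lemma map_fst_plantedMeasure : (plantedMeasure η γ hX).map Prod.fst = γ :=
  Measure.fst_compProd γ _

lemma integral_plantedMeasure {q : E × Y → ℝ} (hq : Measurable q) {C : ℝ} (hC : ∀ z, |q z| ≤ C) :
    ∫ z, q z ∂(plantedMeasure η γ hX) = ∫ x, ∑ i, q (x, i) * labelProb η i (X x) ∂γ := by
  have hi : Integrable q (plantedMeasure η γ hX) :=
    Integrable.of_bound hq.aestronglyMeasurable C (Filter.Eventually.of_forall hC)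
  unfold plantedMeasure at hi ⊢
  rw [Measure.integral_compProd hi]
  refine integral_congr_ae (Filter.Eventually.of_forall fun x => ?_)
  simp only [Kernel.comap_apply]
  rw [integral_fintype (Integrable.of_finite)]
  exact Finset.sum_congr rfl fun i _ => by rw [smul_eq_mul, mul_comm]; rfl

/-- The joint law of features and label depends on `X` only through the law of `X`. All choices of
frame give the same Gaussian law, so target error rates carry over from D. -/
lemma map_plantedMeasure :
    (plantedMeasure η γ hX).map (fun z => (X z.1, z.2)) = (γ.map X) ⊗ₘ η := by
  have hm : Measurable fun z : E × Y => (X z.1, z.2) := by fun_prop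
  have := Measure.isProbabilityMeasure_map (μ := γ) hX.aemeasurable
  ext s hs
  rw [Measure.map_apply hm hs, plantedMeasure, Measure.compProd_apply (hm hs),
    Measure.compProd_apply hs, lintegral_map (Kernel.measurable_kernel_prodMk_left hs) hX]
  rfl

/-- The expectation of a query under the distribution in which the labels are averaged over the
Gaussian component. -/
noncomputable def nullExpectation (q : E × Y → ℝ) (τ : E → T) : ℝ :=
  ∫ x, ∑ i, q (x, i) * meanLabelProb η i (τ x) ∂γ

lemma integral_plantedMeasure_sub {q : E × Y → ℝ} (hq : Measurable q) {C : ℝ}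
    (hC : ∀ z, |q z| ≤ C) :
    ∫ z, q z ∂(plantedMeasure η γ hX) - nullExpectation η γ q (fun x => (X x).1) =
      ∫ x, ∑ i, q (x, i) * labelDev η i (X x) ∂γ := by
  rw [integral_plantedMeasure η γ hX hq hC, nullExpectation, ← integral_sub]
  · refine integral_congr_ae (Filter.Eventually.of_forall fun x => ?_)
    simp only [← Finset.sum_sub_distrib, labelDev, mul_sub]
  all_goals
    refine integrable_finsetSum _ fun i _ => Integrable.of_bound (C := C * 1)
      (Measurable.aestronglyMeasurable ?_) (Filter.Eventually.of_forall fun x => ?_)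
  · exact (hq.comp measurable_prodMk_right).mul ((measurable_labelProb η i).comp hX)
  · rw [Real.norm_eq_abs, abs_mul, abs_of_nonneg (labelProb_nonneg η i _)]
    exact mul_le_mul (hC _) (labelProb_le_one η i _) (labelProb_nonneg η i _)
      ((abs_nonneg _).trans (hC (x, i)))
  · exact (hq.comp measurable_prodMk_right).mul ((measurable_meanLabelProb η i).comp hX.fst)
  · rw [Real.norm_eq_abs, abs_mul, abs_of_nonneg (meanLabelProb_nonneg η i _)]
    exact mul_le_mul (hC _) (meanLabelProb_le_one η i _) (meanLabelProb_nonneg η i _)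
      ((abs_nonneg _).trans (hC (x, i)))

end

/-! ### Integrability of the moments -/

/-- A power is dominated by an exponential, and a quarter of the exponent is at most (|u|² +
|y|²)/4, within the range of Gaussian integrability. -/
lemma integrable_mehlerExponent_pow {κ : Type*} [Fintype κ] {ρ : ℝ} (hρ : |ρ| ≤ 1 / 2)
    (u : κ → ℝ) (j : ℕ) : Integrable (fun y => mehlerExponent ρ u y ^ j) (gaussPi κ) := by
  have hexp := (integral_exp_sum_sq_gaussPi (κ := κ) (c := 1 / 4) (by norm_num)).1
  refine Integrable.mono' (hexp.const_mul (4 ^ j * j.factorial * Real.exp (1 / 4 * ∑ i, u i ^ 2)))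
    ((measurable_mehlerExponent ρ u).pow_const j).aestronglyMeasurable
    (Filter.Eventually.of_forall fun y => ?_)
  have h1 := abs_mehlerExponent_le hρ le_rfl u y
  set x := |mehlerExponent ρ u y| with hx
  have h2 : (x / 4) ^ j ≤ j.factorial * Real.exp (x / 4) := by
    have := Real.pow_div_factorial_le_exp (x / 4) (by positivity) j
    rw [div_le_iff₀ (by positivity)] at this
    linarith
  rw [Real.norm_eq_abs, abs_pow]
  calc x ^ j = 4 ^ j * (x / 4) ^ j := by rw [← mul_pow]; congr 1; ring
    _ ≤ 4 ^ j * (j.factorial * Real.exp (x / 4)) := by gcongr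
    _ ≤ 4 ^ j * (j.factorial * Real.exp (1 / 4 * ∑ i, u i ^ 2 + 1 / 4 * ∑ i, y i ^ 2)) := by
      gcongr; linarith
    _ = _ := by rw [Real.exp_add]; ring

/-! ### From conditional moments of D to moments of the label deviations -/

namespace SQLower

variable {d : ℕ} {Y : Type*} [Fintype Y] [MeasurableSpace Y] [DiscreteMeasurableSpace Y]
  {D : Measure (Eu d × Y)}

lemma HasGaussianMarginal.isProbabilityMeasure (hD : HasGaussianMarginal D) :
    IsProbabilityMeasure D := by
  have : IsProbabilityMeasure (D.map Prod.fst) := by rw [hD]; infer_instance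
  exact (Measure.isProbabilityMeasure_map_iff measurable_fst.aemeasurable).1 this

/-- The powers of `mehlerExponent` are polynomials in the hidden component. -/
lemma exists_mvPolynomial_mehlerExponent (S : Submodule ℝ (Eu d)) (ρ : ℝ)
    (u : Fin (Module.finrank ℝ S) → ℝ) (j : ℕ) (c : ℝ) :
    ∃ p : MvPolynomial (Fin d) ℝ, p.totalDegree ≤ 2 * j ∧ ∀ x : Eu d,
      MvPolynomial.eval (fun l => S.starProjection x l) p =
        mehlerExponent ρ u (coords (subBasis S) x) ^ j - c := by
  set û : Eu d := ∑ i, u i • subBasis S i with hû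
  set P : MvPolynomial (Fin d) ℝ :=
    MvPolynomial.C (ρ / (1 - ρ ^ 2)) * ∑ l, MvPolynomial.C (û l) * MvPolynomial.X l -
      MvPolynomial.C (ρ ^ 2 / 2 / (1 - ρ ^ 2)) * ∑ l, MvPolynomial.X l ^ 2 with hP
  have hdeg : P.totalDegree ≤ 2 := by
    refine (MvPolynomial.totalDegree_sub _ _).trans (max_le ?_ ?_)
    · refine (MvPolynomial.totalDegree_mul _ _).trans ?_
      rw [MvPolynomial.totalDegree_C, zero_add]
      refine MvPolynomial.totalDegree_finsetSum_le fun l _ => ?_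
      refine (MvPolynomial.totalDegree_mul _ _).trans ?_
      rw [MvPolynomial.totalDegree_C, MvPolynomial.totalDegree_X]
      norm_num
    · refine (MvPolynomial.totalDegree_mul _ _).trans ?_
      rw [MvPolynomial.totalDegree_C, zero_add]
      refine MvPolynomial.totalDegree_finsetSum_le fun l _ => ?_
      refine (MvPolynomial.totalDegree_pow _ _).trans ?_
      rw [MvPolynomial.totalDegree_X]
  refine ⟨P ^ j - MvPolynomial.C c, ?_, fun x => ?_⟩
  · refine (MvPolynomial.totalDegree_sub _ _).trans (max_le ?_ (by simp))
    refine (MvPolynomial.totalDegree_pow _ _).trans ?_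
    rw [mul_comm]
    gcongr
  · have h1 : ∑ l, û l * S.starProjection x l = ∑ i, u i * coords (subBasis S) x i := by
      have : ∑ l, û l * S.starProjection x l = ⟪û, S.starProjection x⟫ := by
        simp [PiLp.inner_apply, mul_comm]
      rw [this, hû, sum_inner]
      refine Finset.sum_congr rfl fun i _ => ?_
      rw [real_inner_smul_left, ← coords_subBasis_starProjection le_rfl x]
      rfl
    have h2 : ∑ l, S.starProjection x l ^ 2 = ∑ i, coords (subBasis S) x i ^ 2 := by
      rw [← EuclideanSpace.real_norm_sq_eq, ← real_inner_self_eq_norm_sq]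
      conv_lhs => rw [← sum_coords_subBasis]
      rw [(orthonormal_subBasis S).inner_sum]
      simp [sq]
    rw [map_sub, map_pow, MvPolynomial.eval_C, hP, map_sub, map_mul, map_mul, map_sum, map_sum]
    simp only [MvPolynomial.eval_C, map_mul, map_pow, MvPolynomial.eval_X]
    rw [h1, h2, mehlerExponent]
    congr 2
    ring

section

variable (V W : Submodule ℝ (Eu d))

/-- The coordinates in the visible and the hidden subspace. -/
noncomputable def visHidCoords (x : Eu d) :
    (Fin (Module.finrank ℝ (visibleSubspace V W)) → ℝ) ×
      (Fin (Module.finrank ℝ (hiddenSubspace V W)) → ℝ) :=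
  (coords (subBasis (visibleSubspace V W)) x, coords (subBasis (hiddenSubspace V W)) x)

lemma measurable_visHidCoords : Measurable (visHidCoords V W) := by
  unfold visHidCoords; fun_prop

lemma map_visHidCoords : (stdGaussian (Eu d)).map (visHidCoords V W) =
    (gaussPi _).prod (gaussPi _) :=
  map_coords_prod_stdGaussian (orthonormal_sumElim (orthonormal_subBasis _)
    (orthonormal_subBasis _) fun i j =>
      inner_visible_hidden V W (subBasis_mem _ i) (subBasis_mem _ j))

variable [Nonempty Y] (D)

/-- The conditional distribution of the label given the visible and the hidden coordinates. -/
noncomputable def labelKernel [IsFiniteMeasure D] :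
    Kernel ((Fin (Module.finrank ℝ (visibleSubspace V W)) → ℝ) ×
      (Fin (Module.finrank ℝ (hiddenSubspace V W)) → ℝ)) Y :=
  condDistrib Prod.snd (fun z : Eu d × Y => visHidCoords V W z.1) D

instance [IsFiniteMeasure D] : IsMarkovKernel (labelKernel D V W) := by
  unfold labelKernel; infer_instance

variable {D}

lemma map_visHidCoords_label [IsFiniteMeasure D] (hD : HasGaussianMarginal D) :
    D.map (fun z => (visHidCoords V W z.1, z.2)) =
      ((gaussPi _).prod (gaussPi _)) ⊗ₘ labelKernel D V W := by
  rw [← map_visHidCoords, ← hD, Measure.map_map (measurable_visHidCoords V W) measurable_fst]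
  exact (compProd_map_condDistrib measurable_snd.aemeasurable).symm

lemma integral_label_eq [IsFiniteMeasure D] (hD : HasGaussianMarginal D) (i : Y)
    {G : (Fin (Module.finrank ℝ (visibleSubspace V W)) → ℝ) ×
      (Fin (Module.finrank ℝ (hiddenSubspace V W)) → ℝ) → ℝ} (hG : Measurable G)
    (hGi : Integrable G ((gaussPi _).prod (gaussPi _))) :
    ∫ z, {z : Eu d × Y | z.2 = i}.indicator (fun z => G (visHidCoords V W z.1)) z ∂D =
      ∫ z, G z * labelProb (labelKernel D V W) i z ∂((gaussPi _).prod (gaussPi _)) := by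
  have hm : Measurable fun z : Eu d × Y => (visHidCoords V W z.1, z.2) := by
    have := measurable_visHidCoords V W
    fun_prop
  set H := fun z : ((Fin (Module.finrank ℝ (visibleSubspace V W)) → ℝ) ×
      (Fin (Module.finrank ℝ (hiddenSubspace V W)) → ℝ)) × Y =>
    {z : _ × Y | z.2 = i}.indicator (fun z => G z.1) z with hH
  have hs : MeasurableSet {z : ((Fin (Module.finrank ℝ (visibleSubspace V W)) → ℝ) ×
      (Fin (Module.finrank ℝ (hiddenSubspace V W)) → ℝ)) × Y | z.2 = i} :=
    measurable_snd (MeasurableSet.singleton i)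
  have hHm : Measurable H := (hG.comp measurable_fst).indicator hs
  have hGc : Integrable (fun z : _ × Y => G z.1)
      (((gaussPi _).prod (gaussPi _)) ⊗ₘ labelKernel D V W) := by
    have h := Measure.fst_compProd ((gaussPi _).prod (gaussPi _)) (labelKernel D V W)
    rw [← h] at hGi
    exact hGi.comp_measurable measurable_fst
  have h1 : ∫ z, {z : Eu d × Y | z.2 = i}.indicator (fun z => G (visHidCoords V W z.1)) z ∂D =
      ∫ z, H z ∂(D.map (fun z => (visHidCoords V W z.1, z.2))) := by
    rw [integral_map hm.aemeasurable hHm.aestronglyMeasurable]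
    rfl
  rw [h1, map_visHidCoords_label V W hD, Measure.integral_compProd (hGc.indicator hs)]
  refine integral_congr_ae (Filter.Eventually.of_forall fun z => ?_)
  have h2 : (fun y : Y => H (z, y)) = ({i} : Set Y).indicator (fun _ => G z) := by
    ext y
    by_cases h : y = i
    · rw [Set.indicator_of_mem (show y ∈ ({i} : Set Y) from h)]
      exact Set.indicator_of_mem (s := {z : _ × Y | z.2 = i}) h _
    · rw [Set.indicator_of_notMem (show y ∉ ({i} : Set Y) from h)]
      exact Set.indicator_of_notMem (s := {z : _ × Y | z.2 = i}) h _
  have h3 : ∫ y, H (z, y) ∂(labelKernel D V W z) =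
      ∫ y, ({i} : Set Y).indicator (fun _ => G z) y ∂(labelKernel D V W z) := by rw [← h2]
  refine h3.trans ?_
  rw [integral_indicator_const _ (MeasurableSet.singleton i), smul_eq_mul, mul_comm]
  rfl

/-- The moments of the deviations of the label probabilities vanish up to degree `m`. -/
lemma integral_labelDev_moment_eq_zero [IsFiniteMeasure D] (hD : HasGaussianMarginal D) {m : ℕ}
    (hmom : MomentsVanish D V W m) (i : Y) {j : ℕ} (hj : 2 * j ≤ m) {ρ : ℝ} (hρ : |ρ| ≤ 1 / 2)
    (u : Fin (Module.finrank ℝ (hiddenSubspace V W)) → ℝ)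
    {ψ : (Fin (Module.finrank ℝ (visibleSubspace V W)) → ℝ) → ℝ} (hψ : Measurable ψ)
    (hψ1 : ∀ t, |ψ t| ≤ 1) :
    Integrable (fun z => ψ z.1 * labelDev (labelKernel D V W) i z * mehlerExponent ρ u z.2 ^ j)
      ((gaussPi _).prod (gaussPi _)) ∧
    ∫ z, ψ z.1 * labelDev (labelKernel D V W) i z * mehlerExponent ρ u z.2 ^ j
      ∂((gaussPi _).prod (gaussPi _)) = 0 := by
  set η := labelKernel D V W with hη
  set μ := gaussPi (Fin (Module.finrank ℝ (visibleSubspace V W))) with hμ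
  set γ := gaussPi (Fin (Module.finrank ℝ (hiddenSubspace V W))) with hγ
  set M := fun y => mehlerExponent ρ u y ^ j with hM
  have hMi : Integrable M γ := integrable_mehlerExponent_pow hρ u j
  have hMm : Measurable M := (measurable_mehlerExponent ρ u).pow_const j
  set c := ∫ y, M y ∂γ with hc
  have hbdd : ∀ g : (Fin (Module.finrank ℝ (visibleSubspace V W)) → ℝ) ×
      (Fin (Module.finrank ℝ (hiddenSubspace V W)) → ℝ) → ℝ, Measurable g → (∀ z, |g z| ≤ 1) →
      Integrable (fun z => g z * M z.2) (μ.prod γ) := by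
    intro g hg hg1
    exact (hMi.comp_snd μ).bdd_mul hg.aestronglyMeasurable
      (Filter.Eventually.of_forall hg1)
  have hψφ : ∀ z, |ψ z.1 * labelDev η i z| ≤ 1 := fun z => by
    rw [abs_mul]; exact mul_le_one₀ (hψ1 _) (abs_nonneg _) (abs_labelDev_le_one η i z)
  have hψη : ∀ z, |ψ z.1 * labelProb η i z| ≤ 1 := fun z => by
    rw [abs_mul, abs_of_nonneg (labelProb_nonneg η i z)]
    exact mul_le_one₀ (hψ1 _) (labelProb_nonneg η i z) (labelProb_le_one η i z)
  have hψe : ∀ t, |ψ t * meanLabelProb η i t| ≤ 1 := fun t => by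
    rw [abs_mul, abs_of_nonneg (meanLabelProb_nonneg η i t)]
    exact mul_le_one₀ (hψ1 _) (meanLabelProb_nonneg η i t) (meanLabelProb_le_one η i t)
  have hψηm : Measurable fun z : (Fin (Module.finrank ℝ (visibleSubspace V W)) → ℝ) ×
      (Fin (Module.finrank ℝ (hiddenSubspace V W)) → ℝ) => ψ z.1 * labelProb η i z :=
    (hψ.comp measurable_fst).mul (measurable_labelProb η i)
  have hψem : Measurable fun t => ψ t * meanLabelProb η i t :=
    hψ.mul (measurable_meanLabelProb η i)
  refine ⟨hbdd (fun z => ψ z.1 * labelDev η i z)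
    ((hψ.comp measurable_fst).mul (measurable_labelDev η i)) hψφ, ?_⟩
  -- the conditional moment vanishes
  have key : ∫ z, (ψ z.1 * (M z.2 - c)) * labelProb η i z ∂(μ.prod γ) = 0 := by
    obtain ⟨p, hp, hpe⟩ := exists_mvPolynomial_mehlerExponent (hiddenSubspace V W) ρ u j c
    have hmapU := map_coords_stdGaussian (orthonormal_subBasis (hiddenSubspace V W))
    have hMx : Integrable (fun x : Eu d => M (coords (subBasis (hiddenSubspace V W)) x) - c)
        (stdGaussian (Eu d)) := by
      have : Integrable (fun y => M y - c) γ := hMi.sub (integrable_const c)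
      rw [hγ, ← hmapU] at this
      exact this.comp_measurable (by fun_prop)
    have hp0 : ∫ x, MvPolynomial.eval (fun l => (hiddenSubspace V W).starProjection x l) p
        ∂(stdGaussian (Eu d)) = 0 := by
      simp_rw [hpe]
      have : ∫ x : Eu d, (M (coords (subBasis (hiddenSubspace V W)) x) - c)
          ∂(stdGaussian (Eu d)) = ∫ y, (M y - c) ∂γ := by
        rw [hγ, ← hmapU, integral_map (by fun_prop) (by fun_prop)]
      rw [this, integral_sub hMi (integrable_const c), integral_const]
      simp [hc]
    have hcond := hmom i p (hp.trans hj) hp0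
    set Z := {z : Eu d × Y | z.2 = i}.indicator (fun z : Eu d × Y =>
      MvPolynomial.eval (fun l => (hiddenSubspace V W).starProjection z.1 l) p) with hZ
    have hVm : Measurable (fun z : Eu d × Y => V.orthogonalProjectionOnto z.1) :=
      V.orthogonalProjectionOnto.continuous.measurable.comp measurable_fst
    have hle := hVm.comap_le
    have hs : MeasurableSet {z : Eu d × Y | z.2 = i} :=
      measurable_snd (MeasurableSet.singleton i)
    have hZi : Integrable Z D := by
      refine Integrable.indicator ?_ hs
      simp_rw [hpe]
      rw [← hD] at hMx
      exact hMx.comp_measurable measurable_fst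
    set Ψ : Eu d × Y → ℝ := fun z => ψ (coords (subBasis (visibleSubspace V W)) z.1) with hΨ
    have hΨm' : Measurable Ψ := hψ.comp ((measurable_coords _).comp measurable_fst)
    have hΨZ : Integrable (Ψ * Z) D :=
      hZi.bdd_mul hΨm'.aestronglyMeasurable (Filter.Eventually.of_forall fun z => hψ1 _)
    set m' := MeasurableSpace.comap (fun z : Eu d × Y => V.orthogonalProjectionOnto z.1)
      inferInstance with hm'
    -- The visible subspace lies in `V`, so a function of the visible coordinates is a function of
    -- x^V and can be pulled out of the conditional expectation.
    have hΨm : StronglyMeasurable[m'] Ψ := by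
      have e : Ψ = (fun v : V => ψ (coords (subBasis (visibleSubspace V W)) (v : Eu d))) ∘
          (fun z : Eu d × Y => V.orthogonalProjectionOnto z.1) := by
        ext z
        simp only [hΨ, Function.comp_apply]
        rw [← Submodule.starProjection_apply,
          coords_subBasis_starProjection (visibleSubspace_le V W)]
      rw [e]
      refine Measurable.stronglyMeasurable ?_
      have h1 : Measurable fun v : V => ψ (coords (subBasis (visibleSubspace V W)) (v : Eu d)) :=
        hψ.comp (by fun_prop)
      exact h1.comp (comap_measurable _)
    have h1 := condExp_mul_of_stronglyMeasurable_left hΨm hΨZ hZi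
    have h2 : ∫ z, (Ψ * Z) z ∂D = 0 := by
      rw [← integral_condExp hle]
      have : D[Ψ * Z | m'] =ᵐ[D] 0 := by
        filter_upwards [h1, hcond] with z hz1 hz2
        rw [hz1, Pi.mul_apply, hz2]
        simp
      rw [integral_congr_ae this]
      simp
    have h3 := integral_label_eq V W hD i (G := fun z => ψ z.1 * (M z.2 - c))
      ((hψ.comp measurable_fst).mul ((hMm.comp measurable_snd).sub_const c))
      (((hMi.sub (integrable_const c)).comp_snd μ).bdd_mul
        (hψ.comp measurable_fst).aestronglyMeasurable (Filter.Eventually.of_forall fun z => hψ1 _))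
    rw [← h3, ← h2]
    refine integral_congr_ae (Filter.Eventually.of_forall fun z => ?_)
    simp only [Pi.mul_apply, hZ, hpe, hΨ, visHidCoords, hM]
    by_cases h : z ∈ {z : Eu d × Y | z.2 = i}
    · rw [Set.indicator_of_mem h, Set.indicator_of_mem h]
    · rw [Set.indicator_of_notMem h, Set.indicator_of_notMem h, mul_zero]
  have hηi : Integrable (fun z : (Fin (Module.finrank ℝ (visibleSubspace V W)) → ℝ) ×
      (Fin (Module.finrank ℝ (hiddenSubspace V W)) → ℝ) => ψ z.1 * labelProb η i z) (μ.prod γ) :=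
    Integrable.of_bound (C := 1) hψηm.aestronglyMeasurable (Filter.Eventually.of_forall hψη)
  -- By `key`, `labelProb` sees `M` only through its mean `c`. By independence of the two components
  -- the same holds for `meanLabelProb` (`e3`), so the two contributions cancel.
  have e1 : ∫ z, ψ z.1 * labelProb η i z * M z.2 ∂(μ.prod γ) =
      c * ∫ z, ψ z.1 * labelProb η i z ∂(μ.prod γ) := by
    have : ∀ z : (Fin (Module.finrank ℝ (visibleSubspace V W)) → ℝ) ×
      (Fin (Module.finrank ℝ (hiddenSubspace V W)) → ℝ),
      (ψ z.1 * (M z.2 - c)) * labelProb η i z =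
        ψ z.1 * labelProb η i z * M z.2 - c * (ψ z.1 * labelProb η i z) := fun z => by ring
    simp_rw [this] at key
    rw [integral_sub (hbdd _ hψηm hψη) (hηi.const_mul c), integral_const_mul] at key
    linarith
  have e2 : ∫ z, ψ z.1 * labelProb η i z ∂(μ.prod γ) = ∫ t, ψ t * meanLabelProb η i t ∂μ := by
    rw [integral_prod _ hηi]
    refine integral_congr_ae (Filter.Eventually.of_forall fun t => ?_)
    exact integral_const_mul (ψ t) fun u => labelProb η i (t, u)
  have e3 : ∫ z, (ψ z.1 * meanLabelProb η i z.1) * M z.2 ∂(μ.prod γ) =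
      (∫ t, ψ t * meanLabelProb η i t ∂μ) * c :=
    integral_prod_mul (fun t => ψ t * meanLabelProb η i t) M
  have e4 : ∀ z : (Fin (Module.finrank ℝ (visibleSubspace V W)) → ℝ) ×
      (Fin (Module.finrank ℝ (hiddenSubspace V W)) → ℝ), ψ z.1 * labelDev η i z * M z.2 =
      ψ z.1 * labelProb η i z * M z.2 - (ψ z.1 * meanLabelProb η i z.1) * M z.2 := fun z => by
    rw [labelDev]; ring
  refine (integral_congr_ae (Filter.Eventually.of_forall e4)).trans ?_
  rw [integral_sub (hbdd _ hψηm hψη) (hbdd (fun z => ψ z.1 * meanLabelProb η i z.1)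
    (hψem.comp measurable_fst) (fun z => hψe z.1)), e1, e2, e3]
  ring

end

end SQLower

/-- This supplies the Bayes predictor of the null distribution. Measurability is kept by induction
on the finite set of labels, comparing one new label with the best so far. -/
lemma exists_measurable_argmax {T Y : Type*} [MeasurableSpace T] [Fintype Y] [Nonempty Y]
    [MeasurableSpace Y] {g : Y → T → ℝ} (hg : ∀ i, Measurable (g i)) :
    ∃ s : T → Y, Measurable s ∧ ∀ t i, g i t ≤ g (s t) t := by
  classical
  suffices h : ∀ A : Finset Y, A.Nonempty → ∃ s : T → Y, Measurable s ∧
      Measurable (fun t => g (s t) t) ∧ ∀ t, ∀ i ∈ A, g i t ≤ g (s t) t by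
    obtain ⟨s, hs, -, h⟩ := h Finset.univ Finset.univ_nonempty
    exact ⟨s, hs, fun t i => h t i (Finset.mem_univ i)⟩
  intro A hA
  induction hA using Finset.Nonempty.cons_induction with
  | singleton a =>
    exact ⟨fun _ => a, measurable_const, hg a, fun t i hi => by rw [Finset.mem_singleton.1 hi]⟩
  | cons a A ha hA ih =>
    obtain ⟨s, hs, hgs, h⟩ := ih
    have hm : MeasurableSet {t | g (s t) t ≤ g a t} := measurableSet_le hgs (hg a)
    refine ⟨fun t => if g (s t) t ≤ g a t then a else s t, measurable_const.ite hm hs, ?_, ?_⟩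
    · have : (fun t => g (if g (s t) t ≤ g a t then a else s t) t) =
          fun t => if g (s t) t ≤ g a t then g a t else g (s t) t := by
        ext t; split_ifs <;> rfl
      rw [this]
      exact (hg a).ite hm hgs
    · intro t i hi
      rw [Finset.mem_cons] at hi
      beta_reduce
      split_ifs with h1
      · rcases hi with rfl | hi
        · exact le_rfl
        · exact (h t i hi).trans h1
      · rcases hi with rfl | hi
        · exact (not_le.1 h1).le
        · exact h t i hi

/-! ### The error of hypotheses under the null distribution -/

namespace SQLower

variable {d : ℕ} {Y : Type*} [Fintype Y] [MeasurableSpace Y] [DiscreteMeasurableSpace Y]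
  {D : Measure (Eu d × Y)}

/-- The query asking for the error of the hypothesis `h`. -/
noncomputable def errQuery (h : Eu d → Y) (z : Eu d × Y) : ℝ :=
  {z : Eu d × Y | h z.1 ≠ z.2}.indicator (fun _ => 1) z

lemma measurableSet_err {h : Eu d → Y} (hh : Measurable h) :
    MeasurableSet {z : Eu d × Y | h z.1 ≠ z.2} :=
  (measurableSet_eq_fun (hh.comp measurable_fst) measurable_snd).compl

lemma measurable_errQuery {h : Eu d → Y} (hh : Measurable h) : Measurable (errQuery h) :=
  measurable_const.indicator (measurableSet_err hh)

lemma abs_errQuery_le_one (h : Eu d → Y) (z : Eu d × Y) : |errQuery h z| ≤ 1 := by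
  classical
  rw [errQuery, Set.indicator_apply]
  split_ifs <;> simp

lemma sum_errQuery_mul (h : Eu d → Y) (x : Eu d) {r : Y → ℝ} {c : ℝ} (hr : ∑ i, r i = c) :
    ∑ i, errQuery h (x, i) * r i = c - r (h x) := by
  classical
  have : ∀ i, errQuery h (x, i) * r i = r i - if i = h x then r i else 0 := by
    intro i
    by_cases hi : i = h x
    · simp [errQuery, hi]
    · have : h x ≠ i := fun e => hi e.symm
      simp [errQuery, hi, this]
  simp_rw [this]
  rw [Finset.sum_sub_distrib, hr]
  simp

lemma integral_errQuery {h : Eu d → Y} (hh : Measurable h) (μ : Measure (Eu d × Y)) :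
    ∫ z, errQuery h z ∂μ = err01 μ h := by
  unfold errQuery
  rw [integral_indicator_const _ (measurableSet_err hh)]
  simp [err01]

section

variable (V W : Submodule ℝ (Eu d)) [Nonempty Y]

lemma plantedMeasure_real_eq [IsFiniteMeasure D] (hD : HasGaussianMarginal D)
    {X : Eu d → (Fin (Module.finrank ℝ (visibleSubspace V W)) → ℝ) ×
      (Fin (Module.finrank ℝ (hiddenSubspace V W)) → ℝ)} (hX : Measurable X)
    (hlaw : (stdGaussian (Eu d)).map X = (gaussPi _).prod (gaussPi _)) {A : Set (_ × Y)}
    (hA : MeasurableSet A) :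
    (plantedMeasure (labelKernel D V W) (stdGaussian (Eu d)) hX).real {z | (X z.1, z.2) ∈ A} =
      D.real {z | (visHidCoords V W z.1, z.2) ∈ A} := by
  have h1 := map_plantedMeasure (labelKernel D V W) (stdGaussian (Eu d)) hX
  rw [hlaw, ← map_visHidCoords_label V W hD] at h1
  have hm1 : Measurable fun z : Eu d × Y => (X z.1, z.2) := by fun_prop
  have hm2 : Measurable fun z : Eu d × Y => (visHidCoords V W z.1, z.2) := by
    have := measurable_visHidCoords V W
    fun_prop
  have h2 := congrArg (fun μ => μ.real A) h1
  simp only [Measure.real, Measure.map_apply hm1 hA, Measure.map_apply hm2 hA] at h2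
  exact h2

/-- If no function of the projection to `V` predicts `f` well, then no hypothesis predicts the
averaged labels well. -/
lemma le_nullExpectation_errQuery [IsProbabilityMeasure D] (hD : HasGaussianMarginal D)
    {f : Eu d → Y} (hf : Measurable f) {τ : ℝ} {m : ℕ} (hmom : MomentsVanish D V W m)
    (hτ : ∀ g : V → Y, Measurable g →
      τ ≤ (stdGaussian (Eu d)).real {x | g (V.orthogonalProjectionOnto x) ≠ f x})
    {h : Eu d → Y} (hh : Measurable h) :
    τ - err01 D f ≤ nullExpectation (labelKernel D V W) (stdGaussian (Eu d)) (errQuery h)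
      (coords (subBasis (visibleSubspace V W))) := by
  set η := labelKernel D V W with hη
  set cT : Eu d → _ := coords (subBasis (visibleSubspace V W)) with hcT
  have hcTm : Measurable cT := measurable_coords _
  obtain ⟨s, hs, hmax⟩ := exists_measurable_argmax (measurable_meanLabelProb η)
  have hsm : Measurable fun x => s (cT x) := hs.comp hcTm
  have hint : ∀ h : Eu d → Y, Measurable h →
      Integrable (fun x => ∑ i, errQuery h (x, i) * meanLabelProb η i (cT x))
        (stdGaussian (Eu d)) := by
    intro h hh
    refine integrable_finsetSum _ fun i _ => Integrable.of_bound (C := 1)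
      (Measurable.aestronglyMeasurable ?_) (Filter.Eventually.of_forall fun x => ?_)
    · exact ((measurable_errQuery hh).comp measurable_prodMk_right).mul
        ((measurable_meanLabelProb η i).comp hcTm)
    · rw [Real.norm_eq_abs, abs_mul, abs_of_nonneg (meanLabelProb_nonneg η i _)]
      exact mul_le_one₀ (abs_errQuery_le_one _ _) (meanLabelProb_nonneg η i _)
        (meanLabelProb_le_one η i _)
  -- Given x, the null error of a guess is 1 minus the mean probability of that label, so `s` is
  -- optimal pointwise.
  have h1 : nullExpectation η (stdGaussian (Eu d)) (errQuery fun x => s (cT x)) cT ≤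
      nullExpectation η (stdGaussian (Eu d)) (errQuery h) cT := by
    refine integral_mono (hint _ hsm) (hint _ hh) fun x => ?_
    simp only
    rw [sum_errQuery_mul _ _ (sum_meanLabelProb η _), sum_errQuery_mul _ _ (sum_meanLabelProb η _)]
    linarith [hmax (cT x) (h x)]
  have hX := measurable_visHidCoords V W
  have h2 : ∫ z, errQuery (fun x => s (cT x)) z ∂(plantedMeasure η (stdGaussian (Eu d)) hX) =
      nullExpectation η (stdGaussian (Eu d)) (errQuery fun x => s (cT x)) cT := by
    have e := integral_plantedMeasure_sub η (stdGaussian (Eu d)) hX (measurable_errQuery hsm)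
      (abs_errQuery_le_one _)
    have hz : ∫ x, ∑ i, errQuery (fun x => s (cT x)) (x, i) * labelDev η i (visHidCoords V W x)
        ∂(stdGaussian (Eu d)) = 0 := by
      classical
      set ψ : Y → (Fin (Module.finrank ℝ (visibleSubspace V W)) → ℝ) → ℝ :=
        fun i t => if s t = i then 0 else 1 with hψ
      have hψm : ∀ i, Measurable (ψ i) := fun i =>
        measurable_const.ite (hs (MeasurableSet.singleton i)) measurable_const
      have hψ1 : ∀ i t, |ψ i t| ≤ 1 := by
        intro i t; simp only [hψ]; split_ifs <;> simp
      have e1 : ∀ x i, errQuery (fun x => s (cT x)) (x, i) * labelDev η i (visHidCoords V W x) =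
          (fun z => ψ i z.1 * labelDev η i z) (visHidCoords V W x) := by
        intro x i
        simp only [errQuery, hψ, Set.indicator_apply, Set.mem_ofPred_eq, visHidCoords, ite_not]
        rfl
      simp_rw [e1]
      have hψd : ∀ i, Measurable fun z : _ × (Fin (Module.finrank ℝ (hiddenSubspace V W)) → ℝ) =>
          ψ i z.1 * labelDev η i z := fun i =>
        ((hψm i).comp measurable_fst).mul (measurable_labelDev η i)
      rw [integral_finsetSum]
      · refine Finset.sum_eq_zero fun i _ => ?_
        rw [← integral_map (φ := visHidCoords V W) hX.aemeasurable
          (f := fun z => ψ i z.1 * labelDev η i z) (hψd i).aestronglyMeasurable,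
          map_visHidCoords]
        -- Only the zeroth moment is needed: a predictor of the visible coordinates does not notice
        -- that the labels have been averaged over the hidden ones.
        have := (integral_labelDev_moment_eq_zero V W hD hmom i (j := 0) (Nat.zero_le _)
          (ρ := 0) (by simp) (fun _ => 0) (hψm i) (hψ1 i)).2
        simpa using this
      · intro i _
        refine Integrable.of_bound (C := 1) ((hψd i).comp hX).aestronglyMeasurable
          (Filter.Eventually.of_forall fun x => ?_)
        rw [Real.norm_eq_abs, abs_mul]
        exact mul_le_one₀ (hψ1 _ _) (abs_nonneg _) (abs_labelDev_le_one η i _)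
    rw [hz] at e
    exact sub_eq_zero.1 e
  have h3 : err01 (plantedMeasure η (stdGaussian (Eu d)) hX) (fun x => s (cT x)) =
      err01 D fun x => s (cT x) := by
    have hA : MeasurableSet {z : ((Fin (Module.finrank ℝ (visibleSubspace V W)) → ℝ) ×
        (Fin (Module.finrank ℝ (hiddenSubspace V W)) → ℝ)) × Y | s z.1.1 ≠ z.2} :=
      (measurableSet_eq_fun (hs.comp (measurable_fst.comp measurable_fst)) measurable_snd).compl
    exact plantedMeasure_real_eq V W hD hX (map_visHidCoords V W) hA
  rw [integral_errQuery hsm, h3] at h2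
  have h4 := hτ (fun v => s (cT (v : Eu d))) (hs.comp (hcTm.comp measurable_subtype_coe))
  have h5 : (stdGaussian (Eu d)).real {x | s (cT (V.orthogonalProjectionOnto x : Eu d)) ≠ f x} =
      D.real {z | s (cT z.1) ≠ f z.1} := by
    have e : {x : Eu d | s (cT (V.orthogonalProjectionOnto x : Eu d)) ≠ f x} =
        {x | s (cT x) ≠ f x} := by
      ext x
      simp only [Set.mem_ofPred_eq, hcT]
      rw [← Submodule.starProjection_apply,
        coords_subBasis_starProjection (visibleSubspace_le V W)]
    have hm : MeasurableSet {x : Eu d | s (cT x) ≠ f x} := (measurableSet_eq_fun hsm hf).compl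
    rw [e, ← hD, Measure.real, Measure.map_apply measurable_fst hm]
    rfl
  -- If `s` and `f` disagree, one of them differs from the label; this is where one OPT is lost.
  have h6 : D.real {z | s (cT z.1) ≠ f z.1} ≤ err01 D (fun x => s (cT x)) + err01 D f := by
    refine (measureReal_mono ?_ (measure_ne_top _ _)).trans (measureReal_union_le _ _)
    intro z hz
    by_contra hc
    simp only [Set.mem_union, Set.mem_ofPred_eq, not_or, not_not] at hc hz
    exact hz (hc.1.trans hc.2.symm)
  linarith

end

end SQLower

/-! ### Planted instances and the lower bound -/

namespace SQLower

variable {d : ℕ} {Y : Type*} [Fintype Y] [MeasurableSpace Y] [DiscreteMeasurableSpace Y]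
  {D : Measure (Eu d × Y)} (V W : Submodule ℝ (Eu d))

lemma vstatTolerance_pos {X : Type*} [MeasurableSpace X] (D : Measure X) (q : StatQuery X) {a : ℝ}
    (ha : 0 < a) : 0 < vstatTolerance D q a :=
  lt_max_of_lt_left (by positivity)

lemma le_vstatTolerance {X : Type*} [MeasurableSpace X] (D : Measure X) (q : StatQuery X) (a : ℝ) :
    1 / a ≤ vstatTolerance D q a := le_max_left _ _

section

variable {κ : Type*} {n : ℕ}

/-- The coordinates in the visible subspace and in the frame of a sign vector. -/
noncomputable def frameCoords (e : κ × Fin n → Eu d) (v : Fin n → Bool) (x : Eu d) :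
    (Fin (Module.finrank ℝ (visibleSubspace V W)) → ℝ) × (κ → ℝ) :=
  (coords (subBasis (visibleSubspace V W)) x, coords (signFrame e v) x)

lemma measurable_frameCoords [Fintype κ] (e : κ × Fin n → Eu d) (v : Fin n → Bool) :
    Measurable (frameCoords V W e v) := by
  unfold frameCoords; fun_prop

variable {V W}

lemma map_frameCoords [Fintype κ] {e : κ × Fin n → Eu d} (he : Orthonormal ℝ e) (hn : 0 < n)
    (hte : ∀ t ∈ visibleSubspace V W, ∀ p, ⟪t, e p⟫ = 0) (v : Fin n → Bool) :
    (stdGaussian (Eu d)).map (frameCoords V W e v) = (gaussPi _).prod (gaussPi _) :=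
  map_coords_prod_stdGaussian (orthonormal_sumElim (orthonormal_subBasis _)
    (orthonormal_signFrame he hn v) fun i _ =>
      inner_signFrame_right_eq_zero (hte _ (subBasis_mem _ i)) v _)

variable {e : Fin (Module.finrank ℝ (hiddenSubspace V W)) × Fin n → Eu d}

lemma abs_sum_integral_labelDev_le [Nonempty Y] [IsProbabilityMeasure D]
    (hD : HasGaussianMarginal D) {m : ℕ} (hmom : MomentsVanish D V W m) (he : Orthonormal ℝ e)
    (hn : 0 < n) (hte : ∀ t ∈ visibleSubspace V W, ∀ p, ⟪t, e p⟫ = 0) {K : ℕ} (hK : 1 ≤ K)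
    (hWK : Module.finrank ℝ W ≤ K) {ε : ℝ} (hε : 16 * K * ε ≤ 1) {v w : Fin n → Bool}
    (hvw : |signDot v w| ≤ n * ε) :
    |∑ i, ∫ x, labelDev (labelKernel D V W) i (frameCoords V W e v x) *
        labelDev (labelKernel D V W) i (frameCoords V W e w x) ∂(stdGaussian (Eu d))| ≤
      8 * ((m / 2 + 1 : ℕ) * (16 * K * ε)) ^ (m / 2 + 1) := by
  have hK' : (1 : ℝ) ≤ K := by exact_mod_cast hK
  have hn' : (0 : ℝ) < n := by exact_mod_cast hn
  set ρ := signDot v w / n with hρ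
  have hρε : |ρ| ≤ ε := by
    rw [hρ, abs_div, abs_of_pos hn', div_le_iff₀ hn', mul_comm]; exact hvw
  have hε0 : 0 ≤ ε := (abs_nonneg _).trans hρε
  have hε2 : ε ≤ 1 / 2 := by nlinarith
  have hρ1 : ρ ^ 2 < 1 := by rw [← sq_abs]; nlinarith [abs_nonneg ρ]
  -- The j-th Taylor term has degree 2j in the hidden coordinates, so all terms with j < m/2 + 1 are
  -- covered by the moments up to degree m.
  have hcorr := abs_sum_integral_corr_le (gaussPi (Fin (Module.finrank ℝ (visibleSubspace V W))))
    (measurable_labelDev (labelKernel D V W)) (abs_labelDev_le_one (labelKernel D V W))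
    (sum_abs_labelDev_le_two (labelKernel D V W)) (n := m / 2 + 1) hK
    (by rw [Fintype.card_fin]; exact (finrank_hiddenSubspace_le V W).trans hWK) hρε hε
    fun i j hj u ψ hψ hψ1 => integral_labelDev_moment_eq_zero V W hD hmom i
      (by omega) (hρε.trans hε2) u hψ hψ1
  refine le_of_eq_of_le ?_ hcorr
  congr 1
  refine Finset.sum_congr rfl fun i _ => ?_
  have hlaw := map_coords_triple (orthonormal_subBasis (visibleSubspace V W)) he
    (fun i p => hte _ (subBasis_mem _ i) p) hn hρ1
  have hφ := measurable_labelDev (labelKernel D V W) i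
  rw [← hlaw, integral_map (by fun_prop)]
  · refine integral_congr_ae (Filter.Eventually.of_forall fun x => ?_)
    simp only [frameCoords]
    rw [coords_signFrame_eq hρ1 x]
  · exact ((hφ.comp (by fun_prop)).mul (hφ.comp (by fun_prop))).aestronglyMeasurable

/-- A query distinguishes few of the planted distributions from the null distribution. -/
lemma card_distinguished_le [Nonempty Y] [IsProbabilityMeasure D]
    (hD : HasGaussianMarginal D) {m : ℕ} (hmom : MomentsVanish D V W m) (he : Orthonormal ℝ e)
    (hn : 0 < n) (hte : ∀ t ∈ visibleSubspace V W, ∀ p, ⟪t, e p⟫ = 0) {K : ℕ} (hK : 1 ≤ K)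
    (hWK : Module.finrank ℝ W ≤ K) {ε : ℝ} (hε0 : 0 ≤ ε) (hε : 16 * K * ε ≤ 1) {q : Eu d → Y → ℝ}
    (hq : ∀ i, Measurable fun x => q x i) {L : ℝ} (hqL : ∀ x, ∑ i, q x i ^ 2 ≤ L) {θ : ℝ}
    (hθ : 0 ≤ θ) :
    (θ ^ 2 - L * (8 * ((m / 2 + 1 : ℕ) * (16 * K * ε)) ^ (m / 2 + 1))) *
      (Finset.univ.filter fun v => θ < |∫ x, ∑ i, q x i *
        labelDev (labelKernel D V W) i (frameCoords V W e v x) ∂(stdGaussian (Eu d))|).card ≤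
      L * (2 * (2 * (2 ^ n * Real.exp (-(n * ε ^ 2 / 2))))) := by
  refine card_integral_gt_le (stdGaussian (Eu d))
    (φ := fun v i x => labelDev (labelKernel D V W) i (frameCoords V W e v x))
    (fun v i => (measurable_labelDev _ i).comp (measurable_frameCoords V W e v))
    (fun v i x => abs_labelDev_le_one _ i _) (fun v x => sum_abs_labelDev_le_two _ _)
    (by positivity) (by positivity) (fun v => ?_) hq hqL hθ
  refine le_trans ?_ (card_abs_signDot_gt_le v hε0)
  refine Nat.cast_le.2 (Finset.card_le_card fun w hw => ?_)
  rw [Finset.mem_filter] at hw ⊢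
  refine ⟨Finset.mem_univ w, ?_⟩
  by_contra hc
  exact absurd hw.2 (not_lt.2 (abs_sum_integral_labelDev_le hD hmom he hn hte hK hWK hε
    (not_lt.1 hc)))

end

variable {V W}

/-- The lower bound, with explicit parameters. -/
theorem exists_noisyInstance_of_learns [IsProbabilityMeasure D]
    (hD : HasGaussianMarginal D) {m K n : ℕ} (hK : 1 ≤ K) (hn : 0 < n)
    (hKn : K * n + K ≤ d) {f : Eu d → Y} (hf : Measurable f) {τ opt θ ε M : ℝ}
    (hopt : err01 D f = opt) (hWK : Module.finrank ℝ W ≤ K)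
    (hfW : ∀ x, f x = f (W.starProjection x))
    (hτ : ∀ g : V → Y, Measurable g →
      τ ≤ (stdGaussian (Eu d)).real {x | g (V.orthogonalProjectionOnto x) ≠ f x})
    (hmom : MomentsVanish D V W m) (hε0 : 0 ≤ ε) (hε : 16 * K * ε ≤ 1) (hθ : 0 < θ)
    (hθopt : θ ≤ opt)
    (hC : 8 * ((m / 2 + 1 : ℕ) * (16 * K * ε)) ^ (m / 2 + 1) ≤ θ ^ 2 / 2) (hM : 0 ≤ M)
    (hMn : (M + 1) * (8 * Real.exp (-(n * ε ^ 2 / 2))) < 2 / 3 * θ ^ 2)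
    {F : Set (Eu d → Y)} (hF : rotatedFamily f V W ⊆ F)
    {Ω : Type*} [MeasurableSpace Ω] (P : Measure Ω) [IsProbabilityMeasure P]
    (A : Ω → SQAlg (Eu d × Y) (Hyp d Y)) (hA : Learns P A F opt (τ - 2 * opt)) :
    ∃ D' : Measure (Eu d × Y), IsNoisyInstance F opt D' ∧
      ∃ O : StatQuery (Eu d × Y) → ℝ → ℝ, IsVSTATOracle D' O ∧
        ∃ᵐ ω ∂P, M ≤ ((A ω).numQueries O : ℝ) ∨
          ∃ s ∈ (A ω).accuracies O, 1 / (Fintype.card Y * θ) ≤ s := by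
  classical
  by_contra hcon
  push Not at hcon
  have : Nonempty Y := ⟨f 0⟩
  have hY : (1 : ℝ) ≤ Fintype.card Y := by exact_mod_cast Fintype.card_pos
  set η := labelKernel D V W with hη
  have hfin := (finrank_visibleSubspace_le V W).trans hWK
  obtain ⟨e, he, hte⟩ := exists_orthonormal_orthogonal (visibleSubspace V W)
    (k := Module.finrank ℝ (hiddenSubspace V W)) (n := n) (by
      have := Nat.mul_le_mul_right n ((finrank_hiddenSubspace_le V W).trans hWK)
      omega)
  -- the planted instances
  set X := frameCoords V W e with hX
  have hXm : ∀ v, Measurable (X v) := measurable_frameCoords V W e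
  set γ := stdGaussian (Eu d) with hγ
  set Dv : (Fin n → Bool) → Measure (Eu d × Y) := fun v => plantedMeasure η γ (hXm v) with hDv
  have hDvp : ∀ v, IsProbabilityMeasure (Dv v) := fun v => by
    simp only [hDv]; infer_instance
  have hnoisy : ∀ v, IsNoisyInstance F opt (Dv v) := by
    intro v
    refine ⟨map_fst_plantedMeasure η γ (hXm v), _, hF (apply_assemble_mem_rotatedFamily V W hfW
      (orthonormal_signFrame he hn v) fun t ht j => inner_signFrame_right_eq_zero (hte t ht) v j),
      ?_⟩
    have hA : MeasurableSet {z : ((Fin (Module.finrank ℝ (visibleSubspace V W)) → ℝ) ×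
        (Fin (Module.finrank ℝ (hiddenSubspace V W)) → ℝ)) × Y |
        f (assemble V W z.1) ≠ z.2} :=
      (measurableSet_eq_fun (hf.comp ((measurable_assemble V W).comp measurable_fst))
        measurable_snd).compl
    have h1 := plantedMeasure_real_eq V W hD (hXm v) (map_frameCoords he hn hte v) hA
    have h2 : {z : Eu d × Y | (visHidCoords V W z.1, z.2) ∈
        {z : ((Fin (Module.finrank ℝ (visibleSubspace V W)) → ℝ) ×
        (Fin (Module.finrank ℝ (hiddenSubspace V W)) → ℝ)) × Y | f (assemble V W z.1) ≠ z.2}} =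
        {z | f z.1 ≠ z.2} := by
      ext z
      exact not_congr (by rw [visHidCoords, apply_assemble V W hfW])
    rw [h2] at h1
    exact (h1.trans hopt).le
  set E0 : StatQuery (Eu d × Y) → ℝ := fun q =>
    nullExpectation η γ q.toFun (coords (subBasis (visibleSubspace V W))) with hE0
  have hdiff : ∀ q : StatQuery (Eu d × Y), ∀ v, ∫ z, q.toFun z ∂(Dv v) - E0 q =
      ∫ x, ∑ i, q.toFun (x, i) * labelDev η i (X v x) ∂γ := fun q v =>
    integral_plantedMeasure_sub η γ (hXm v) q.measurable_toFun
      (fun z => abs_le.2 (q.mem_Icc z))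
  -- The oracle gives the null expectation whenever the tolerance permits this, and otherwise the
  -- true one; so it is always valid.
  set O : (Fin n → Bool) → StatQuery (Eu d × Y) → ℝ → ℝ := fun v q a =>
    if |E0 q - ∫ z, q.toFun z ∂(Dv v)| ≤ vstatTolerance (Dv v) q a then E0 q
    else ∫ z, q.toFun z ∂(Dv v) with hO
  have hvalid : ∀ v, IsVSTATOracle (Dv v) (O v) := by
    intro v q a ha
    simp only [hO]
    split_ifs with h
    · exact h
    · rw [sub_self, abs_zero]
      exact (vstatTolerance_pos _ q ha).le
  -- the sizes of the sets of distinguished instances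
  set β : ℝ := 8 * (2 ^ n * Real.exp (-(n * ε ^ 2 / 2))) / θ ^ 2 with hβ
  have hcard : ∀ (q : Eu d → Y → ℝ), (∀ i, Measurable fun x => q x i) → ∀ L : ℝ, 1 ≤ L →
      (∀ x, ∑ i, q x i ^ 2 ≤ L) →
      ((Finset.univ.filter fun v => L * θ < |∫ x, ∑ i, q x i * labelDev η i (X v x) ∂γ|).card : ℝ)
        ≤ β := by
    intro q hq L hL hqL
    have h := card_distinguished_le hD hmom he hn hte hK hWK hε0 hε hq hqL
      (θ := L * θ) (by positivity)
    set N := ((Finset.univ.filter fun v =>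
      L * θ < |∫ x, ∑ i, q x i * labelDev η i (X v x) ∂γ|).card : ℝ) with hN
    have hN0 : 0 ≤ N := Nat.cast_nonneg _
    rw [hβ, le_div_iff₀ (by positivity)]
    -- The threshold Lθ makes the factor L cancel on both sides, so one bound `β` serves both L =
    -- |Y| (general queries) and L = 1 (the final error).
    have h1 : L * (θ ^ 2 / 2) ≤ (L * θ) ^ 2 -
        L * (8 * ((m / 2 + 1 : ℕ) * (16 * K * ε)) ^ (m / 2 + 1)) := by
      have h2 : L * (8 * ((m / 2 + 1 : ℕ) * (16 * K * ε)) ^ (m / 2 + 1)) ≤ L * (θ ^ 2 / 2) := by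
        gcongr
      have h3 : L * θ ^ 2 ≤ (L * θ) ^ 2 := by
        rw [mul_pow]; gcongr; nlinarith
      linarith
    have h4 := (mul_le_mul_of_nonneg_right h1 hN0).trans h
    rw [mul_assoc] at h4
    have h5 := le_of_mul_le_mul_left h4 (by linarith)
    linarith
  set bad : StatQuery (Eu d × Y) → Finset (Fin n → Bool) := fun q =>
    Finset.univ.filter fun v => Fintype.card Y * θ <
      |∫ x, ∑ i, q.toFun (x, i) * labelDev η i (X v x) ∂γ| with hbad
  have hbadcard : ∀ q, (bad q).card ≤ ⌊β⌋₊ := by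
    intro q
    refine Nat.le_floor (hcard (fun x i => q.toFun (x, i)) (fun i =>
      q.measurable_toFun.comp measurable_prodMk_right) _ hY fun x => ?_)
    calc ∑ i, q.toFun (x, i) ^ 2 ≤ ∑ _i : Y, (1 : ℝ) := Finset.sum_le_sum fun i _ =>
          (sq_le_one_iff_abs_le_one _).2 (abs_le.2 (q.mem_Icc _))
      _ = _ := by simp
  have hOE : ∀ v q a, 0 < a → a < 1 / (Fintype.card Y * θ) → v ∉ bad q → O v q a = E0 q := by
    intro v q a ha haθ hv
    simp only [hbad, Finset.mem_filter, Finset.mem_univ, true_and, not_lt] at hv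
    simp only [hO]
    rw [if_pos]
    rw [abs_sub_comm, hdiff]
    -- Only the part 1/a of the tolerance is used; it exceeds |Y|θ by the bound on `a`.
    refine hv.trans (le_trans ?_ (le_vstatTolerance _ q a))
    rw [le_div_iff₀ ha]
    rw [lt_div_iff₀ (by positivity)] at haθ
    linarith
  -- the successful runs
  choose S hSm hSP hSerr using fun v => hA (Dv v) (hnoisy v) (O v) (hvalid v)
  have hae : ∀ᵐ ω ∂P, ∀ v, ((A ω).numQueries (O v) : ℝ) < M ∧
      ∀ s ∈ (A ω).accuracies (O v), s < 1 / (Fintype.card Y * θ) := by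
    rw [ae_all_iff]
    intro v
    have h := hcon (Dv v) (hnoisy v) (O v) (hvalid v)
    simpa only [Filter.not_frequently, not_or, not_exists, not_and, not_le] using h
  obtain ⟨ω, T, hω, hT, hTcard⟩ := exists_card_filter_mem_ge P S hSm hSP hae
  have : Nonempty (Hyp d Y) := ⟨⟨f, hf⟩⟩
  obtain ⟨h, B, hB, hres⟩ := exists_common_result O E0 bad hOE hbadcard ⌊M⌋₊ (A ω)
  -- The deviations sum to zero over the labels, so the error query may be replaced by the indicator
  -- of h(x) = i, up to sign. Its squares sum to 1, and the error of `h` is controlled to within θ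
  -- instead of |Y|θ.
  set badh := Finset.univ.filter fun v => 1 * θ <
    |∫ x, ∑ i, (if h.1 x = i then (1 : ℝ) else 0) * labelDev η i (X v x) ∂γ| with hbadh
  have hbadhcard : (badh.card : ℝ) ≤ β := by
    refine hcard (fun x i => if h.1 x = i then (1 : ℝ) else 0) (fun i =>
      measurable_const.ite (h.2 (MeasurableSet.singleton i)) measurable_const) 1 le_rfl fun x => ?_
    simp
  -- The queries exclude at most Mβ indices and the final hypothesis at most β more, fewer than two
  -- thirds of the 2ⁿ sign vectors.
  have hlt : (B ∪ badh).card < T.card := by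
    have h1 : ((B ∪ badh).card : ℝ) ≤ (M + 1) * β := by
      have h2 : ((B ∪ badh).card : ℝ) ≤ ⌊M⌋₊ * ⌊β⌋₊ + badh.card := by
        exact_mod_cast (Finset.card_union_le _ _).trans (Nat.add_le_add_right hB _)
      have h3 : (⌊M⌋₊ : ℝ) ≤ M := Nat.floor_le hM
      have hβ0 : 0 ≤ β := by positivity
      have h4 : (⌊β⌋₊ : ℝ) ≤ β := Nat.floor_le hβ0
      have h5 : (⌊M⌋₊ : ℝ) * ⌊β⌋₊ ≤ M * β := mul_le_mul h3 h4 (Nat.cast_nonneg _) hM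
      linarith
    have h2 : (M + 1) * β < 2 / 3 * 2 ^ n := by
      rw [hβ, ← mul_div_assoc, div_lt_iff₀ (by positivity)]
      have := mul_lt_mul_of_pos_right hMn (by positivity : (0 : ℝ) < 2 ^ n)
      linarith
    rw [Fintype.card_fun, Fintype.card_bool, Fintype.card_fin] at hTcard
    push_cast at hTcard
    exact_mod_cast (h1.trans_lt h2).trans_le hTcard
  obtain ⟨v, hvT, hvB⟩ := Finset.exists_mem_notMem_of_card_lt_card hlt
  simp only [Finset.mem_union, not_or] at hvB
  have hr := hres v hvB.1 (Nat.le_floor (hω v).1.le) (hω v).2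
  have herr := hSerr v ω (hT v hvT)
  rw [hr, ← integral_errQuery h.2] at herr
  have hnull := le_nullExpectation_errQuery V W hD hf hmom hτ h.2
  have hΔ := integral_plantedMeasure_sub η γ (hXm v) (measurable_errQuery h.2)
    (abs_errQuery_le_one h.1)
  have hneg : ∫ x, ∑ i, errQuery h.1 (x, i) * labelDev η i (X v x) ∂γ =
      -∫ x, ∑ i, (if h.1 x = i then (1 : ℝ) else 0) * labelDev η i (X v x) ∂γ := by
    rw [← integral_neg]
    refine integral_congr_ae (Filter.Eventually.of_forall fun x => ?_)
    beta_reduce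
    rw [sum_errQuery_mul _ _ (sum_labelDev η (X v x))]
    simp
  have hsmall : |∫ x, ∑ i, (if h.1 x = i then (1 : ℝ) else 0) * labelDev η i (X v x) ∂γ| ≤ θ := by
    have := hvB.2
    simp only [hbadh, Finset.mem_filter, Finset.mem_univ, true_and, not_lt, one_mul] at this
    simpa using this
  rw [hneg] at hΔ
  rw [hopt] at hnull
  have h1 := (abs_le.1 hsmall).2
  have h2 : nullExpectation η γ (errQuery h.1) (fun x => (X v x).1) =
    nullExpectation η γ (errQuery h.1) (coords (subBasis (visibleSubspace V W))) := rfl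
  rw [h2] at hΔ
  change ∫ z, errQuery h.1 z ∂(plantedMeasure η γ (hXm v)) < τ - 2 * opt at herr
  linarith

/-- If the error to be achieved is smaller than `τ - 2 * opt` with `τ < 1`, then learnability
forces `opt < 1 / 2`. -/
lemma opt_lt_half_of_learns (hD : HasGaussianMarginal D) {f : Eu d → Y}
    {τ opt : ℝ} (hτ : τ < 1) (hopt : err01 D f = opt) (hfW : ∀ x, f x = f (W.starProjection x))
    {F : Set (Eu d → Y)} (hF : rotatedFamily f V W ⊆ F)
    {Ω : Type*} [MeasurableSpace Ω] {P : Measure Ω}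
    {A : Ω → SQAlg (Eu d × Y) (Hyp d Y)} (hA : Learns P A F opt (τ - 2 * opt)) :
    opt < 1 / 2 := by
  have hfF : f ∈ F := by
    apply hF
    have := apply_assemble_mem_rotatedFamily V W hfW (orthonormal_subBasis (hiddenSubspace V W))
      fun t ht j => inner_visible_hidden V W ht (subBasis_mem _ j)
    convert this using 1
    ext x
    exact (apply_assemble V W hfW x).symm
  -- The algorithm is run on D itself with exact answers. Some seed succeeds, and the nonnegative
  -- error is below τ - 2 OPT.
  obtain ⟨S, -, hS, hSe⟩ := hA D ⟨hD, f, hfF, hopt.le⟩ (fun q _ => ∫ z, q.toFun z ∂D)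
    fun q a ha => by
      rw [sub_self, abs_zero]
      exact (vstatTolerance_pos _ q ha).le
  have hne : S.Nonempty := by
    by_contra h
    rw [Set.not_nonempty_iff_eq_empty.1 h, measureReal_empty] at hS
    norm_num at hS
  obtain ⟨ω, hω⟩ := hne
  have h0 : 0 ≤ err01 D ((A ω).result fun q _ => ∫ z, q.toFun z ∂D).1 := measureReal_nonneg
  linarith [hSe ω hω]

/-! ### The choice of the parameters -/

/-- With ε = s⁻¹² the base is at most s⁻⁶, since 16 ≤ s⁴ and both m/2 + 1 and K are at most s. With
the rounded-down m/2, 6(m/2 + 1) ≥ 2m + 4 still holds, and s⁴ pays for the constants. -/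
lemma correlation_bound_le {s : ℝ} (hs : 2 ≤ s) {m K : ℕ} (hm : 1 ≤ m) (hms : (m : ℝ) ≤ s)
    (hKs : (K : ℝ) ≤ s) :
    8 * ((m / 2 + 1 : ℕ) * (16 * K * (s ^ 12)⁻¹)) ^ (m / 2 + 1) ≤ ((s ^ m)⁻¹) ^ 2 / 2 := by
  have hs0 : 0 < s := by linarith
  have h1 : ((m / 2 + 1 : ℕ) : ℝ) ≤ s := le_trans (by exact_mod_cast (by omega)) hms
  have h16 : (16 : ℝ) ≤ s ^ 4 := by
    calc (16 : ℝ) = 2 ^ 4 := by norm_num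
      _ ≤ s ^ 4 := by gcongr
  have h2 : ((m / 2 + 1 : ℕ) : ℝ) * (16 * K * (s ^ 12)⁻¹) ≤ (s ^ 6)⁻¹ := by
    calc ((m / 2 + 1 : ℕ) : ℝ) * (16 * K * (s ^ 12)⁻¹) ≤ s * (s ^ 4 * s * (s ^ 12)⁻¹) := by gcongr
      _ = (s ^ 6)⁻¹ := by field_simp
  have h3 : 16 * s ^ (2 * m) ≤ (s ^ 6) ^ (m / 2 + 1) := by
    calc 16 * s ^ (2 * m) ≤ s ^ 4 * s ^ (2 * m) := by gcongr
      _ = s ^ (4 + 2 * m) := (pow_add _ _ _).symm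
      _ ≤ s ^ (6 * (m / 2 + 1)) := pow_le_pow_right₀ (by linarith) (by omega)
      _ = _ := pow_mul _ _ _
  calc 8 * ((m / 2 + 1 : ℕ) * (16 * K * (s ^ 12)⁻¹)) ^ (m / 2 + 1)
      ≤ 8 * ((s ^ 6)⁻¹) ^ (m / 2 + 1) := by gcongr
    _ = 8 * ((s ^ 6) ^ (m / 2 + 1))⁻¹ := by rw [inv_pow]
    _ ≤ 8 * (16 * s ^ (2 * m))⁻¹ := by gcongr
    _ = ((s ^ m)⁻¹) ^ 2 / 2 := by
      rw [inv_pow, ← pow_mul, mul_comm m 2, mul_inv]; ring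

/-- Here nε² ≥ s⁸, and exp(-s⁸/2) beats both 2^s ≤ exp s and s^(2m) ≤ exp(2s²), because s⁸ ≥ 64 s².
At s ≥ 2 the total exponent is at most -116. -/
lemma query_count_lt {s : ℝ} (hs : 2 ≤ s) {m n : ℕ} (hms : (m : ℝ) ≤ s) (hn : s ^ 32 ≤ n) :
    ((2 : ℝ) ^ s + 1) * (8 * Real.exp (-(n * (s ^ 12)⁻¹ ^ 2 / 2))) <
      2 / 3 * ((s ^ m)⁻¹) ^ 2 := by
  have hs0 : 0 < s := by linarith
  have h1 : (2 : ℝ) ^ s ≤ Real.exp s := by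
    rw [← Real.exp_one_rpow]
    exact Real.rpow_le_rpow (by norm_num) (by linarith [Real.add_one_le_exp (1 : ℝ)]) hs0.le
  have h2 : s ^ 8 ≤ n * (s ^ 12)⁻¹ ^ 2 := by
    calc s ^ 8 = s ^ 32 * (s ^ 12)⁻¹ ^ 2 := by field_simp
      _ ≤ _ := by gcongr
  have h3 : s ^ (2 * m) ≤ Real.exp (2 * s ^ 2) := by
    calc s ^ (2 * m) ≤ Real.exp s ^ (2 * m) := by
          gcongr; linarith [Real.add_one_le_exp s]
      _ = Real.exp ((2 * m : ℕ) * s) := (Real.exp_nat_mul _ _).symm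
      _ ≤ Real.exp (2 * s ^ 2) := by
          rw [Real.exp_le_exp]; push_cast; nlinarith
  have h64 : 64 * s ^ 2 ≤ s ^ 8 := by
    have : (64 : ℝ) ≤ s ^ 6 := by
      calc (64 : ℝ) = 2 ^ 6 := by norm_num
        _ ≤ s ^ 6 := by gcongr
    nlinarith [sq_nonneg s]
  have h4 : ((2 : ℝ) ^ s + 1) * (8 * Real.exp (-(n * (s ^ 12)⁻¹ ^ 2 / 2))) * s ^ (2 * m) ≤
      16 * Real.exp (-116) := by
    have h5 : (1 : ℝ) ≤ Real.exp s := Real.one_le_exp hs0.le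
    calc _ ≤ (Real.exp s + Real.exp s) * (8 * Real.exp (-(s ^ 8 / 2))) * Real.exp (2 * s ^ 2) := by
          gcongr
      _ = 16 * Real.exp (s + -(s ^ 8 / 2) + 2 * s ^ 2) := by
          rw [Real.exp_add, Real.exp_add]; ring
      _ ≤ 16 * Real.exp (-116) := by
          gcongr
          nlinarith
  have h5 : 16 * Real.exp (-116) < 2 / 3 := by
    have := Real.add_one_le_exp (116 : ℝ)
    rw [Real.exp_neg, ← div_eq_mul_inv, div_lt_iff₀ (Real.exp_pos _)]
    linarith
  have h6 : ((s ^ m)⁻¹) ^ 2 = (s ^ (2 * m))⁻¹ := by rw [inv_pow, ← pow_mul, mul_comm]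
  rw [h6, ← div_eq_mul_inv, lt_div_iff₀ (by positivity)]
  exact h4.trans_lt h5

/-- The frames need K blocks of n = ⌈s³²⌉ vectors, besides at most K visible dimensions; this is of
order s³³, and d = s⁴⁰ leaves room for the constants. -/
lemma dimension_bound {s : ℝ} (hs : 2 ≤ s) {d K : ℕ} (hd : (d : ℝ) = s ^ 40)
    (hKs : (K : ℝ) ≤ s) : K * ⌈s ^ 32⌉₊ + K ≤ d := by
  have hs0 : 0 < s := by linarith
  have h1 : (⌈s ^ 32⌉₊ : ℝ) ≤ s ^ 32 + 1 := (Nat.ceil_lt_add_one (by positivity)).le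
  have h2 : (1 : ℝ) ≤ s ^ 32 := one_le_pow₀ (by linarith)
  have h3 : (4 : ℝ) ≤ s ^ 7 := by
    calc (4 : ℝ) ≤ 2 ^ 7 := by norm_num
      _ ≤ s ^ 7 := by gcongr
  have h4 : ((K * ⌈s ^ 32⌉₊ + K : ℕ) : ℝ) ≤ d := by
    push_cast
    calc (K : ℝ) * ⌈s ^ 32⌉₊ + K ≤ s * (s ^ 32 + 1) + s := by gcongr
      _ ≤ 4 * (s * s ^ 32) := by nlinarith
      _ ≤ s ^ 7 * (s * s ^ 32) := by gcongr
      _ = d := by rw [hd]; ring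
  exact_mod_cast h4

end SQLower

theorem theorem5p2 :
    ∃ c a c₁ c₂ : ℝ, 0 < c ∧ 0 < a ∧ 0 < c₁ ∧ 0 < c₂ ∧
      ∀ (d K m : ℕ), 1 ≤ d → 1 ≤ K → 1 ≤ m →
      (max m K : ℝ) ≤ (d : ℝ) ^ c →
      ∀ (Y : Type v) [Fintype Y] [MeasurableSpace Y] [DiscreteMeasurableSpace Y]
        (τ opt : ℝ), τ ∈ Set.Ioo (0 : ℝ) 1 → opt ∈ Set.Ioo (0 : ℝ) 1 →
      (d : ℝ) ^ (-(a * m)) ≤ τ → (d : ℝ) ^ (-(a * m)) ≤ opt →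
      ∀ (f : SQLower.Eu d → Y) (D : Measure (SQLower.Eu d × Y))
        (W V : Submodule ℝ (SQLower.Eu d)),
      Measurable f →
      SQLower.HasGaussianMarginal D →
      SQLower.err01 D f = opt →
      Module.finrank ℝ W ≤ K →
      (∀ x, f x = f (W.starProjection x)) →
      (∀ g : V → Y, Measurable g →
        τ ≤ (stdGaussian (SQLower.Eu d)).real {x | g (V.orthogonalProjectionOnto x) ≠ f x}) →
      SQLower.MomentsVanish D V W m →
      ∀ F : Set (SQLower.Eu d → Y), SQLower.rotatedFamily f V W ⊆ F →
      ∀ (Ω : Type w) [MeasurableSpace Ω] (P : Measure Ω) [IsProbabilityMeasure P]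
        (A : Ω → SQLower.SQAlg (SQLower.Eu d × Y) (SQLower.Hyp d Y)),
      SQLower.Learns P A F opt (τ - 2 * opt) →
      ∃ D' : Measure (SQLower.Eu d × Y), SQLower.IsNoisyInstance F opt D' ∧
        ∃ O : SQLower.StatQuery (SQLower.Eu d × Y) → ℝ → ℝ, SQLower.IsVSTATOracle D' O ∧
          ∃ᵐ ω ∂P,
            (2 : ℝ) ^ ((d : ℝ) ^ c₁) ≤ ((A ω).numQueries O : ℝ) ∨
            ∃ s ∈ (A ω).accuracies O, (d : ℝ) ^ (c₂ * m) / (Fintype.card Y : ℝ) ≤ s := by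

  refine ⟨1 / 40, 1 / 40, 1 / 40, 1 / 40, by norm_num, by norm_num, by norm_num, by norm_num, ?_⟩
  intro d K m hd hK hm hdmK Y _ _ _ τ opt hτ hopt hdτ hdopt f D W V hf hD herr hWK hfW hg hmom F hF
    Ω _ P _ A hA
  have := hD.isProbabilityMeasure
  set s : ℝ := (d : ℝ) ^ (1 / 40 : ℝ) with hs
  have hd0 : (0 : ℝ) ≤ d := Nat.cast_nonneg d
  have hs0 : 0 < s := Real.rpow_pos_of_pos (by exact_mod_cast hd) _
  have hds : (d : ℝ) = s ^ 40 := by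
    rw [hs, ← Real.rpow_natCast, ← Real.rpow_mul hd0]; norm_num
  have hsm : (d : ℝ) ^ (1 / 40 * (m : ℝ)) = s ^ m := by
    rw [Real.rpow_mul hd0, Real.rpow_natCast]
  have hsm' : (d : ℝ) ^ (-(1 / 40 * (m : ℝ))) = (s ^ m)⁻¹ := by
    rw [Real.rpow_neg hd0, hsm]
  have hms : (m : ℝ) ≤ s := (le_max_left _ _).trans hdmK
  have hKs : (K : ℝ) ≤ s := (le_max_right _ _).trans hdmK
  rw [hsm'] at hdopt
  rw [hsm]
  -- For m ≥ 2 this is part of m ≤ s. For m = 1 it follows from 1/s ≤ OPT < 1/2, where the second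
  -- inequality comes from learnability; so no lower bound on d is needed.
  have hs2 : 2 ≤ s := by
    rcases hm.eq_or_lt with rfl | h
    · have h1 := SQLower.opt_lt_half_of_learns hD hτ.2 herr hfW hF hA
      rw [pow_one] at hdopt
      have h2 : s⁻¹ ≤ 2⁻¹ := by linarith
      exact (inv_le_inv₀ hs0 (by norm_num)).1 h2
    · exact le_trans (by exact_mod_cast h) hms
  have hε : 16 * (K : ℝ) * (s ^ 12)⁻¹ ≤ 1 := by
    rw [← div_eq_mul_inv, div_le_one (by positivity)]
    calc 16 * (K : ℝ) ≤ 2 ^ 11 * s := by gcongr; norm_num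
      _ ≤ s ^ 11 * s := by gcongr
      _ = s ^ 12 := by ring
  -- The parameters are n = ⌈s³²⌉, ε = s⁻¹², θ = s⁻ᵐ and M = 2^s; then 1/(|Y|θ) = sᵐ/|Y| is the
  -- stated accuracy.
  obtain ⟨D', hD', O, hO, h⟩ := SQLower.exists_noisyInstance_of_learns hD hK
    (Nat.ceil_pos.2 (by positivity : 0 < s ^ 32)) (SQLower.dimension_bound hs2 hds hKs) hf herr
    hWK hfW hg hmom (by positivity) hε (by positivity) hdopt
    (SQLower.correlation_bound_le hs2 hm hms hKs) (by positivity)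
    (SQLower.query_count_lt hs2 hms (Nat.le_ceil _)) hF P A hA
  refine ⟨D', hD', O, hO, h.mono fun ω hω => hω.imp_right ?_⟩
  rintro ⟨t, ht, hle⟩
  refine ⟨t, ht, le_of_eq_of_le ?_ hle⟩
  rw [one_div, mul_inv, inv_inv, div_eq_mul_inv, mul_comm]
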